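/- Let $k$ be a field and $A=k[[x,y]]/(xy)$. Let $E$ be the injective envelope of $\bigoplus_{\mathfrak m}A/\mathfrak m$, where $\mathfrak m$ runs through the maximal ideals of $A$. The Matlis dual of an $A$-module $M$ is $M^\vee=\operatorname{Hom}_A(M,E)$, and $M$ is Matlis reflexive if the evaluation map $M\to (M^\vee)^\vee$, $m\mapsto(\varphi\mapsto\varphi(m))$, is an isomorphism. An $A$-module $M$ is artinian-by-noetherian if it has a noetherian submodule $U$ such that $M/U$ is artinian. A string $C=(C_i)_{i\in I}$ is a word in the alphabet $\{x,y,x^-,y^-\}$, indexed by an interval $I\subseteq\mathbb Z$ (finite or infinite, possibly empty), which has no subword $xy$, $yx$, $x^-y^-$ or $y^-x^-$. It is stabilising if $I$ is infinite and $C_i=C_{i+1}$ whenever $|i|$ is sufficiently large and $i,i+1\in I$. The string $C^-$ is obtained from $C$ by replacing each letter $a$ by $a^-$, where $(a^-)^-=a$. The diagram of $C$ is a line of vertices, consecutive ones being joined by the letters of $C$: the letter $C_i$ joins the vertices $i-1$ and $i$, and for $a\in\{x,y\}$ it is an arrow $i-1\xleftarrow{a}i$ if $C_i=a$ and an arrow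 $i-1\xrightarrow{a}i$ if $C_i=a^-$; the empty word has exactly one vertex. Let $C$ be finite or stabilising. The string module $M(C)$ is the following $A$-module. Its elements are the families $(m_v)_v$ in $k$ indexed by the vertices of $C$, with the condition that, at each infinite end of $C$ all of whose arrows eventually point towards the middle, $m_v=0$ for all $v$ sufficiently far out; there is no condition at an infinite end whose arrows eventually point away from the middle. (So one takes the direct limit, respectively the inverse limit, of the modules given by the truncations of $C$ at that end; for finite $C$ the vertices form a $k$-basis.) A power series acts along the arrows: $(f\cdot m)_w=\sum_u c_f(u,w)\,m_u$, where $c_f(u,w)$ is the coefficient of $a^n$ in $f$ if there is a directed path with $n$ arrows from $u$ to $w$, all labelled by $a\in\{x,y\}$ (the constant coefficient if $u=w$), and $c_f(u,w)=0$ if there is no directed path from $u$ to $w$. Then, for every finite or stabilising string $C$, the $A$-module $M(C)$ is artinian-by-noetherian and Matlis reflexive, and there is an isomorphism of $A$-modules $M(C)^\vee\cong M(C^-)$. -/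

import Mathlib

universe u

/-- `i : M → E` is an injective envelope: `E` is injective and `i` is an essential monomorphism. -/
structure IsInjectiveEnvelope {R M E : Type u} [CommRing R] [AddCommGroup M] [Module R M]
    [AddCommGroup E] [Module R E] (i : M →ₗ[R] E) : Prop where
  injective_module : Module.Injective R E
  injective : Function.Injective i
  essential : ∀ N : Submodule R E, N ⊓ LinearMap.range i = ⊥ → N = ⊥

theorem exists_isInjectiveEnvelope (R M : Type u) [CommRing R] [AddCommGroup M] [Module R M] :
    ∃ (E : ModuleCat.{u} R) (i : M →ₗ[R] E), IsInjectiveEnvelope i := by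
  obtain ⟨Q, hQ, j, hj⟩ : ∃ (Q : ModuleCat.{u} R), Module.Injective R Q ∧
      ∃ j : M →ₗ[R] Q, Function.Injective j := by
    obtain ⟨⟨J, hJ, f, hf⟩⟩ := CategoryTheory.EnoughInjectives.presentation (ModuleCat.of R M)
    have hJ' : CategoryTheory.Injective (ModuleCat.of R J) := hJ
    exact ⟨J, Module.injective_module_of_injective_object R J, f.hom,
      (ModuleCat.mono_iff_injective f).1 hf⟩
  set M₀ := LinearMap.range j with hM₀
  obtain ⟨E, -, hE⟩ := zorn_le_nonempty₀
    {E : Submodule R Q | M₀ ≤ E ∧ ∀ N ≤ E, N ⊓ M₀ = ⊥ → N = ⊥} (by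
      intro c hc hch E₀ hE₀
      refine ⟨sSup c, ⟨(hc hE₀).1.trans (le_sSup hE₀), fun N hN hNM => ?_⟩,
        fun z hz => le_sSup hz⟩
      rw [Submodule.eq_bot_iff]
      intro x hx
      obtain ⟨E, hEc, hxE⟩ := (Submodule.mem_sSup_of_directed ⟨E₀, hE₀⟩ hch.directedOn).1 (hN hx)
      have := (hc hEc).2 (Submodule.span R {x}) (by simpa using hxE) (by
        rw [eq_bot_iff, ← hNM]
        exact inf_le_inf_right _ (by simpa using hx))
      simpa using this) M₀ ⟨le_rfl, fun N hN h => by rwa [inf_eq_left.2 hN] at h⟩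
  obtain ⟨K, -, hK⟩ := zorn_le_nonempty₀ {K : Submodule R Q | K ⊓ E = ⊥} (by
      intro c hc hch K₀ hK₀
      refine ⟨sSup c, ?_, fun z hz => le_sSup hz⟩
      refine (Submodule.eq_bot_iff _).2 ?_
      rintro x ⟨hx, hxE⟩
      obtain ⟨K, hKc, hxK⟩ := (Submodule.mem_sSup_of_directed ⟨K₀, hK₀⟩ hch.directedOn).1 hx
      have h2 : x ∈ K ⊓ E := ⟨hxK, hxE⟩
      rw [hc hKc] at h2
      simpa using h2) ⊥ (by simp)
  have hK0 : ∀ x ∈ K, x ∈ E → x = 0 := fun x h1 h2 => by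
    have h3 : x ∈ K ⊓ E := ⟨h1, h2⟩
    rw [hK.prop] at h3
    simpa using h3
  obtain ⟨h, hh⟩ := hQ.out (K.mkQ ∘ₗ E.subtype) (by
    rw [← LinearMap.ker_eq_bot, Submodule.eq_bot_iff]
    rintro ⟨x, hx⟩ h0
    have : x ∈ K := by simpa using h0
    exact Subtype.ext (hK0 x this hx)) E.subtype
  have hh' : ∀ x ∈ E, h (K.mkQ x) = x := fun x hx => hh ⟨x, hx⟩
  have key : ∀ N : Submodule R Q, N ⊓ E = ⊥ → ∀ q, h (K.mkQ q) ∈ N → q ∈ K := by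
    intro N hN q hq
    have h1 : (N.comap (h ∘ₗ K.mkQ)) ⊓ E = ⊥ := by
      rw [Submodule.eq_bot_iff]
      rintro x ⟨hx, hxE⟩
      have h2 : x ∈ N := by
        have : h (K.mkQ x) ∈ N := hx
        rwa [hh' x hxE] at this
      have h3 : x ∈ N ⊓ E := ⟨h2, hxE⟩
      rw [hN] at h3
      simpa using h3
    have h2 : K ≤ N.comap (h ∘ₗ K.mkQ) := by
      intro y hy
      have : K.mkQ y = 0 := by simpa using hy
      simp only [Submodule.mem_comap, LinearMap.comp_apply, this, map_zero, Submodule.zero_mem]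
    exact hK.le_of_ge h1 h2 hq
  have hr : LinearMap.range (h ∘ₗ K.mkQ) ≤ E := by
    refine hE.le_of_ge ⟨?_, ?_⟩ ?_
    · intro x hx
      exact ⟨x, hh' x (hE.prop.1 hx)⟩
    · intro N hN hNM
      have h1 : N ⊓ E = ⊥ := hE.prop.2 _ inf_le_right (by
        rw [eq_bot_iff, ← hNM]
        exact inf_le_inf_right _ inf_le_left)
      rw [Submodule.eq_bot_iff]
      intro x hx
      obtain ⟨q, rfl⟩ := hN hx
      have : K.mkQ q = 0 := by simpa using key N h1 q hx
      simp only [LinearMap.comp_apply, this, map_zero]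
    · intro x hx
      exact ⟨x, hh' x hx⟩
  have hME : ∀ m, j m ∈ E := fun m => hE.prop.1 ⟨m, rfl⟩
  refine ⟨ModuleCat.of R E, j.codRestrict E hME, ⟨?_⟩, ?_, ?_⟩
  · intro X Y _ _ _ _ f hf g
    obtain ⟨g', hg'⟩ := hQ.out f hf (E.subtype ∘ₗ g)
    refine ⟨((h ∘ₗ K.mkQ).codRestrict E fun q => hr ⟨q, rfl⟩) ∘ₗ g', fun x => Subtype.ext ?_⟩
    have h1 : g' (f x) = (g x : Q) := hg' x
    change h (K.mkQ (g' (f x))) = _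
    rw [h1, hh' _ (g x).2]
  · intro a b hab
    exact hj (congrArg Subtype.val hab)
  · intro (N : Submodule R E) hN
    have h1 : N.map E.subtype = ⊥ := by
      refine hE.prop.2 _ (Submodule.map_subtype_le E N) ?_
      rw [Submodule.eq_bot_iff]
      rintro _ ⟨⟨x, hx, rfl⟩, ⟨m, hm⟩⟩
      have h2 : x ∈ N ⊓ LinearMap.range (j.codRestrict E hME) := ⟨hx, ⟨m, Subtype.ext hm⟩⟩
      rw [hN] at h2
      simp only [Submodule.mem_bot] at h2
      simp [h2]
    rw [Submodule.eq_bot_iff] at h1 ⊢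
    intro x hx
    exact Subtype.ext (h1 x ⟨x, hx, rfl⟩)

/-- The minimal injective cogenerator `E = E(∐ A/𝔪)`: the injective envelope of the coproduct of
the simple modules `A/𝔪`, one for each maximal ideal `𝔪`. -/
abbrev MatlisModule (R : Type u) [CommRing R] : Type u :=
  ↥(Classical.choose (exists_isInjectiveEnvelope R
    (DirectSum (MaximalSpectrum R) fun I => R ⧸ I.asIdeal)))

/-- The Matlis dual `M^∨ = Hom_A(M, E)`. -/
abbrev MatlisDual (R : Type u) [CommRing R] (M : Type*) [AddCommGroup M] [Module R M] :=
  M →ₗ[R] MatlisModule R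

/-- `M` is Matlis reflexive: the evaluation `M → (M^∨)^∨`, `m ↦ (φ ↦ φ m)`, is an isomorphism. -/
def IsMatlisReflexive (R : Type u) [CommRing R] (M : Type*) [AddCommGroup M] [Module R M] : Prop :=
  Function.Bijective
    (LinearMap.applyₗ : M →ₗ[R] MatlisDual R M →ₗ[R] MatlisModule R)

/-- `M` is artinian-by-noetherian: an extension of an artinian quotient by a noetherian
submodule. -/
def IsArtinianByNoetherian (R : Type*) [CommRing R] (M : Type*) [AddCommGroup M] [Module R M] :
    Prop :=
  ∃ U : Submodule R M, IsNoetherian R U ∧ IsArtinian R (M ⧸ U)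

/-- The alphabet `{x, y, x⁻, y⁻}`: `dir 0 = x`, `dir 1 = y`, `inv 0 = x⁻`, `inv 1 = y⁻`. -/
inductive StringLetter
  | dir (a : Fin 2)
  | inv (a : Fin 2)

/-- The involution `a ↦ a⁻` of the alphabet. -/
def StringLetter.flip : StringLetter → StringLetter
  | dir a => inv a
  | inv a => dir a

/-- A string: a word `(C_i)_{i ∈ I}` indexed by an interval `I ⊆ ℤ` (finite or infinite, possibly
empty) without subwords `xy`, `yx`, `x⁻y⁻`, `y⁻x⁻`. It is encoded as a partial function on `ℤ`:
`letter i = some a` means `i ∈ I` and `C_i = a`, and `letter i = none` means `i ∉ I`. -/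
structure StringWord where
  letter : ℤ → Option StringLetter
  ordConnected : {i : ℤ | (letter i).isSome}.OrdConnected
  dir_dir : ∀ i a b, letter i = some (.dir a) → letter (i + 1) = some (.dir b) → a = b
  inv_inv : ∀ i a b, letter i = some (.inv a) → letter (i + 1) = some (.inv b) → a = b

namespace StringWord

/-- The index interval `I`. -/
def support (C : StringWord) : Set ℤ := {i | (C.letter i).isSome}

/-- The inverted string `C⁻`: every letter `a` is replaced by `a⁻`, in place. -/
def invert (C : StringWord) : StringWord where
  letter i := (C.letter i).map StringLetter.flip
  ordConnected := by simpa using C.ordConnected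
  dir_dir i a b h1 h2 := by
    obtain ⟨c, hc, hca⟩ := Option.map_eq_some_iff.1 h1
    obtain ⟨d, hd, hdb⟩ := Option.map_eq_some_iff.1 h2
    cases c <;> cases d <;> simp_all [StringLetter.flip]
    exact C.inv_inv i _ _ hc hd
  inv_inv i a b h1 h2 := by
    obtain ⟨c, hc, hca⟩ := Option.map_eq_some_iff.1 h1
    obtain ⟨d, hd, hdb⟩ := Option.map_eq_some_iff.1 h2
    cases c <;> cases d <;> simp_all [StringLetter.flip]
    exact C.dir_dir i _ _ hc hd

def IsFinite (C : StringWord) : Prop := C.support.Finite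

/-- An infinite string with `C_i = C_{i+1}` for `|i| ≫ 0`. -/
def IsStabilising (C : StringWord) : Prop :=
  C.support.Infinite ∧ ∃ N : ℤ, ∀ i : ℤ, N ≤ |i| → i ∈ C.support → i + 1 ∈ C.support →
    C.letter i = C.letter (i + 1)

/-- The vertices of the diagram of `C`. The letter `C_i` is the arrow between the vertices `i - 1`
and `i`: it is `i - 1 ⟵a i` if `C_i = a` and `i - 1 ⟶a i` if `C_i = a⁻`, for `a ∈ {x, y}`.
The empty word has the single vertex `0`. -/
def vertices (C : StringWord) : Set ℤ :=
  {v | v ∈ C.support ∨ v + 1 ∈ C.support ∨ (C.support = ∅ ∧ v = 0)}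

/-- The diagram continues to the left indefinitely with arrows `⋯ ⟶ ∘ ⟶ ∘ ⟶ ⋯` pointing towards
the middle. -/
def LeftInward (C : StringWord) : Prop :=
  ∃ N : ℤ, ∀ i ≤ N, ∃ a, C.letter i = some (.inv a)

/-- The diagram continues to the right indefinitely with arrows `⋯ ⟵ ∘ ⟵ ∘ ⟵ ⋯` pointing towards
the middle. -/
def RightInward (C : StringWord) : Prop :=
  ∃ N : ℤ, ∀ i ≥ N, ∃ a, C.letter i = some (.dir a)

/-- There is a directed path from the vertex `u` to the vertex `w` all of whose arrows carry the
label `a` (`0` for `x` and `1` for `y`); it then has length `|u - w|`. As `xy`, `yx`, `x⁻y⁻`,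
`y⁻x⁻` are excluded, every directed path in the diagram is of this form. -/
def Path (C : StringWord) (a : Fin 2) (u w : ℤ) : Prop :=
  (w ≤ u ∧ ∀ i, w < i → i ≤ u → C.letter i = some (.dir a)) ∨
    (u ≤ w ∧ ∀ i, u < i → i ≤ w → C.letter i = some (.inv a))

theorem Path.refl (C : StringWord) (a : Fin 2) (u : ℤ) : C.Path a u u :=
  Or.inl ⟨le_rfl, fun i h1 h2 => by omega⟩

theorem Path.trans {C : StringWord} {a b : Fin 2} {u v w : ℤ} (h1 : C.Path a u v)
    (h2 : C.Path b v w) (huv : u ≠ v) (hvw : v ≠ w) :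
    a = b ∧ C.Path a u w ∧ (u < v ∧ v < w ∨ w < v ∧ v < u) := by
  rcases h1 with ⟨l1, h1⟩ | ⟨l1, h1⟩ <;> rcases h2 with ⟨l2, h2⟩ | ⟨l2, h2⟩
  · have e1 := h1 (v + 1) (by omega) (by omega)
    have e2 := h2 v (by omega) (by omega)
    obtain rfl := C.dir_dir _ _ _ e2 e1
    refine ⟨rfl, Or.inl ⟨by omega, fun i hi hi' => ?_⟩, by omega⟩
    by_cases hiv : i ≤ v
    · exact h2 i hi hiv
    · exact h1 i (by omega) hi'
  · have e1 := h1 (v + 1) (by omega) (by omega)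
    have e2 := h2 (v + 1) (by omega) (by omega)
    simp [e1] at e2
  · have e1 := h1 v (by omega) (by omega)
    have e2 := h2 v (by omega) (by omega)
    simp [e1] at e2
  · have e1 := h1 v (by omega) (by omega)
    have e2 := h2 (v + 1) (by omega) (by omega)
    obtain rfl := C.inv_inv _ _ _ e1 e2
    refine ⟨rfl, Or.inr ⟨by omega, fun i hi hi' => ?_⟩, by omega⟩
    by_cases hiv : i ≤ v
    · exact h1 i hi hiv
    · exact h2 i (by omega) hi'

theorem Path.split {C : StringWord} {a : Fin 2} {u v w : ℤ} (h : C.Path a u w)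
    (hv : u ≤ v ∧ v ≤ w ∨ w ≤ v ∧ v ≤ u) : C.Path a u v ∧ C.Path a v w := by
  rcases h with ⟨l, h⟩ | ⟨l, h⟩
  · exact ⟨Or.inl ⟨by omega, fun i _ _ => h i (by omega) (by omega)⟩,
      Or.inl ⟨by omega, fun i _ _ => h i (by omega) (by omega)⟩⟩
  · exact ⟨Or.inr ⟨by omega, fun i _ _ => h i (by omega) (by omega)⟩,
      Or.inr ⟨by omega, fun i _ _ => h i (by omega) (by omega)⟩⟩

theorem Path.unique {C : StringWord} {a b : Fin 2} {u w : ℤ} (h1 : C.Path a u w)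
    (h2 : C.Path b u w) (hne : u ≠ w) : a = b := by
  rcases h1 with ⟨l1, h1⟩ | ⟨l1, h1⟩ <;> rcases h2 with ⟨l2, h2⟩ | ⟨l2, h2⟩
  · have e1 := h1 u (by omega) (by omega)
    have e2 := h2 u (by omega) (by omega)
    simp_all
  · omega
  · omega
  · have e1 := h1 w (by omega) (by omega)
    have e2 := h2 w (by omega) (by omega)
    simp_all

section Action

variable (k : Type u) [Field k] (C : StringWord)

open Classical in
/-- The matrix entry of the power series `f` from the vertex `u` to the vertex `w`: the coefficient
of `a ^ n` in `f` if there is a directed path from `u` to `w` of length `n` with label `a` (the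
constant coefficient if `u = w`), and `0` if there is no such path. -/
noncomputable def pathCoeff (f : MvPowerSeries (Fin 2) k) (u w : ℤ) : k :=
  if C.Path 0 u w then MvPowerSeries.coeff (Finsupp.single 0 (u - w).natAbs) f
  else if C.Path 1 u w then MvPowerSeries.coeff (Finsupp.single 1 (u - w).natAbs) f
  else 0

/-- The underlying vector space of the string module, as a space of coefficient families
`m = (m_v)` on the vertices (extended by zero to `ℤ`).

For a finite string this is the space with the vertices as a basis. At an infinite end whose arrows
point towards the middle, the string module is the direct limit (here: the union) of the modules of
the truncations, so `m` has to vanish far out. At an infinite end whose arrows point away from the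
middle, it is the inverse limit of the modules of the truncations, so `m` is arbitrary there. -/
def carrier : Submodule k (ℤ → k) where
  carrier := {m | (∀ v ∉ C.vertices, m v = 0) ∧
    (C.LeftInward → ∃ N : ℤ, ∀ v ≤ N, m v = 0) ∧
    (C.RightInward → ∃ N : ℤ, ∀ v ≥ N, m v = 0)}
  zero_mem' := ⟨fun _ _ => rfl, fun _ => ⟨0, fun _ _ => rfl⟩, fun _ => ⟨0, fun _ _ => rfl⟩⟩
  add_mem' := by
    rintro m n ⟨h1, h2, h3⟩ ⟨h1', h2', h3'⟩
    refine ⟨fun v hv => by simp [h1 v hv, h1' v hv], fun h => ?_, fun h => ?_⟩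
    · obtain ⟨N, hN⟩ := h2 h
      obtain ⟨N', hN'⟩ := h2' h
      exact ⟨min N N', fun v hv => by
        simp [hN v (hv.trans (min_le_left _ _)), hN' v (hv.trans (min_le_right _ _))]⟩
    · obtain ⟨N, hN⟩ := h3 h
      obtain ⟨N', hN'⟩ := h3' h
      exact ⟨max N N', fun v hv => by
        simp [hN v ((le_max_left _ _).trans hv), hN' v ((le_max_right _ _).trans hv)]⟩
  smul_mem' := by
    rintro c m ⟨h1, h2, h3⟩
    refine ⟨fun v hv => by simp [h1 v hv], fun h => ?_, fun h => ?_⟩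
    · obtain ⟨N, hN⟩ := h2 h
      exact ⟨N, fun v hv => by simp [hN v hv]⟩
    · obtain ⟨N, hN⟩ := h3 h
      exact ⟨N, fun v hv => by simp [hN v hv]⟩

/-- The action of a power series in `x` and `y` along the arrows:
`(f • m)_w = ∑_u pathCoeff f u w * m_u`. The sum has only finitely many non-zero terms for `m` in
`carrier`. In particular `x` sends a vertex to the sum of the targets of the arrows labelled `x`
which start there (and so does `y`). -/
noncomputable def act (f : MvPowerSeries (Fin 2) k) (m : ℤ → k) (w : ℤ) : k :=
  ∑ᶠ u : ℤ, C.pathCoeff k f u w * m u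

variable {k} {C}

theorem pathCoeff_of_path {f : MvPowerSeries (Fin 2) k} {a : Fin 2} {u w : ℤ}
    (h : C.Path a u w) :
    C.pathCoeff k f u w = MvPowerSeries.coeff (Finsupp.single a (u - w).natAbs) f := by
  unfold pathCoeff
  by_cases hne : u = w
  · subst hne
    simp [Path.refl]
  · split_ifs with h0 h1
    · rw [h.unique h0 hne]
    · rw [h.unique h1 hne]
    · fin_cases a <;> simp_all

theorem exists_path_of_pathCoeff_ne_zero {f : MvPowerSeries (Fin 2) k} {u w : ℤ}
    (h : C.pathCoeff k f u w ≠ 0) : ∃ a, C.Path a u w := by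
  unfold pathCoeff at h
  split_ifs at h with h0 h1
  · exact ⟨0, h0⟩
  · exact ⟨1, h1⟩
  · exact absurd rfl h

theorem pathCoeff_add (f g : MvPowerSeries (Fin 2) k) (u w : ℤ) :
    C.pathCoeff k (f + g) u w = C.pathCoeff k f u w + C.pathCoeff k g u w := by
  unfold pathCoeff
  split_ifs <;> simp

theorem exists_bound {m : ℤ → k} (hm : m ∈ C.carrier k) (w : ℤ) :
    ∃ N : ℤ, ∀ u a, C.Path a u w → m u ≠ 0 → |u| ≤ N := by
  have hR : ∃ N : ℤ, ∀ u a, C.Path a u w → m u ≠ 0 → u ≤ N := by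
    by_cases h : ∀ i > w, ∃ a, C.letter i = some (.dir a)
    · obtain ⟨N, hN⟩ := hm.2.2 ⟨w + 1, fun i hi => h i (by omega)⟩
      exact ⟨N, fun u a _ hu => by
        by_contra hlt
        exact hu (hN u (by omega))⟩
    · push Not at h
      obtain ⟨i, hi, hi'⟩ := h
      refine ⟨i, fun u a hp _ => ?_⟩
      by_contra hlt
      rcases hp with ⟨_, hp⟩ | ⟨hp, _⟩
      · exact hi' a (hp i (by omega) (by omega))
      · omega
  have hL : ∃ N : ℤ, ∀ u a, C.Path a u w → m u ≠ 0 → N ≤ u := by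
    by_cases h : ∀ i ≤ w, ∃ a, C.letter i = some (.inv a)
    · obtain ⟨N, hN⟩ := hm.2.1 ⟨w, fun i hi => h i (by omega)⟩
      exact ⟨N, fun u a _ hu => by
        by_contra hlt
        exact hu (hN u (by omega))⟩
    · push Not at h
      obtain ⟨i, hi, hi'⟩ := h
      refine ⟨i, fun u a hp _ => ?_⟩
      by_contra hlt
      rcases hp with ⟨hp, _⟩ | ⟨_, hp⟩
      · omega
      · exact hi' a (hp i (by omega) (by omega))
  obtain ⟨N, hN⟩ := hR
  obtain ⟨N', hN'⟩ := hL
  refine ⟨max |N| |N'|, fun u a hp hu => ?_⟩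
  have h1 := hN u a hp hu
  have h2 := hN' u a hp hu
  rw [abs_le]
  have h3 := le_abs_self N
  have h4 := neg_abs_le N'
  have h5 := le_max_left |N| |N'|
  have h6 := le_max_right |N| |N'|
  omega

theorem act_eq_sum (f : MvPowerSeries (Fin 2) k) {m : ℤ → k} {w : ℤ} {T : Finset ℤ}
    (hT : ∀ u a, C.Path a u w → m u ≠ 0 → u ∈ T) :
    C.act k f m w = ∑ u ∈ T, C.pathCoeff k f u w * m u := by
  refine finsum_eq_sum_of_support_subset _ fun u hu => ?_
  obtain ⟨a, ha⟩ := exists_path_of_pathCoeff_ne_zero (left_ne_zero_of_mul hu)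
  exact hT u a ha (right_ne_zero_of_mul hu)

theorem exists_finset {m : ℤ → k} (hm : m ∈ C.carrier k) (w : ℤ) :
    ∃ T : Finset ℤ, ∀ u a, C.Path a u w → m u ≠ 0 → u ∈ T := by
  obtain ⟨N, hN⟩ := exists_bound hm w
  exact ⟨Finset.Icc (-N) N, fun u a h1 h2 => Finset.mem_Icc.2 (abs_le.1 (hN u a h1 h2))⟩

theorem act_ne_zero {f : MvPowerSeries (Fin 2) k} {m : ℤ → k} {w : ℤ}
    (h : C.act k f m w ≠ 0) : ∃ u a, C.Path a u w ∧ m u ≠ 0 := by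
  have h' : ∃ u, C.pathCoeff k f u w * m u ≠ 0 := by
    by_contra hc
    push Not at hc
    exact h (by simp [act, hc])
  obtain ⟨u, hu⟩ := h'
  obtain ⟨a, ha⟩ := exists_path_of_pathCoeff_ne_zero (left_ne_zero_of_mul hu)
  exact ⟨u, a, ha, right_ne_zero_of_mul hu⟩

theorem act_mem (f : MvPowerSeries (Fin 2) k) {m : ℤ → k} (hm : m ∈ C.carrier k) :
    C.act k f m ∈ C.carrier k := by
  refine ⟨fun v hv => ?_, fun h => ?_, fun h => ?_⟩
  · by_contra hne
    obtain ⟨u, a, hp, hu⟩ := act_ne_zero hne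
    by_cases huv : u = v
    · subst huv
      exact hu (hm.1 u hv)
    · refine hv ?_
      rcases hp with ⟨l, hp⟩ | ⟨l, hp⟩
      · right; left
        change (C.letter (v + 1)).isSome
        simp [hp (v + 1) (by omega) (by omega)]
      · left
        change (C.letter v).isSome
        simp [hp v (by omega) (by omega)]
  · obtain ⟨N, hN⟩ := hm.2.1 h
    obtain ⟨N', hN'⟩ := h
    refine ⟨min N (N' - 1), fun v hv => ?_⟩
    by_contra hne
    obtain ⟨u, a, hp, hu⟩ := act_ne_zero hne
    have h1 : N < u := by
      by_contra hlt
      exact hu (hN u (by omega))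
    rcases hp with ⟨l, hp⟩ | ⟨l, hp⟩
    · obtain ⟨b, hb⟩ := hN' (v + 1) (by omega)
      have := hp (v + 1) (by omega) (by omega)
      simp [this] at hb
    · omega
  · obtain ⟨N, hN⟩ := hm.2.2 h
    obtain ⟨N', hN'⟩ := h
    refine ⟨max N N', fun v hv => ?_⟩
    by_contra hne
    obtain ⟨u, a, hp, hu⟩ := act_ne_zero hne
    have h1 : u < N := by
      by_contra hlt
      exact hu (hN u (by omega))
    rcases hp with ⟨l, hp⟩ | ⟨l, hp⟩
    · omega
    · obtain ⟨b, hb⟩ := hN' v (by omega)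
      have := hp v (by omega) (by omega)
      simp [this] at hb

theorem act_add (f : MvPowerSeries (Fin 2) k) {m n : ℤ → k} (hm : m ∈ C.carrier k)
    (hn : n ∈ C.carrier k) : C.act k f (m + n) = C.act k f m + C.act k f n := by
  funext w
  obtain ⟨T, hT⟩ := exists_finset hm w
  obtain ⟨T', hT'⟩ := exists_finset hn w
  have h : ∀ u a, C.Path a u w → (m + n) u ≠ 0 → u ∈ T ∪ T' := fun u a hp hu => by
    by_contra hc
    simp only [Finset.mem_union, not_or] at hc
    refine hu ?_
    have e1 : m u = 0 := by
      by_contra h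
      exact hc.1 (hT u a hp h)
    have e2 : n u = 0 := by
      by_contra h
      exact hc.2 (hT' u a hp h)
    simp [e1, e2]
  rw [Pi.add_apply, act_eq_sum f h,
    act_eq_sum f (T := T ∪ T') fun u a hp hu => Finset.mem_union_left _ (hT u a hp hu),
    act_eq_sum f (T := T ∪ T') fun u a hp hu => Finset.mem_union_right _ (hT' u a hp hu),
    ← Finset.sum_add_distrib]
  simp [mul_add]

theorem add_act (f g : MvPowerSeries (Fin 2) k) {m : ℤ → k} (hm : m ∈ C.carrier k) :
    C.act k (f + g) m = C.act k f m + C.act k g m := by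
  funext w
  obtain ⟨T, hT⟩ := exists_finset hm w
  rw [Pi.add_apply, act_eq_sum _ hT, act_eq_sum _ hT, act_eq_sum _ hT, ← Finset.sum_add_distrib]
  simp [pathCoeff_add, add_mul]

theorem act_smul (f : MvPowerSeries (Fin 2) k) (c : k) (m : ℤ → k) :
    C.act k f (c • m) = c • C.act k f m := by
  funext w
  simp only [act, Pi.smul_apply]
  rw [smul_finsum]
  exact finsum_congr fun u => by simp [mul_left_comm]

theorem pathCoeff_mul (f g : MvPowerSeries (Fin 2) k) {u w : ℤ} {T : Finset ℤ}
    (hT : Finset.Icc (min u w) (max u w) ⊆ T) :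
    ∑ v ∈ T, C.pathCoeff k f v w * C.pathCoeff k g u v = C.pathCoeff k (f * g) u w := by
  classical
  by_cases h : ∃ a, C.Path a u w
  · obtain ⟨a, ha⟩ := h
    rw [pathCoeff_of_path ha, MvPowerSeries.coeff_mul, Finsupp.antidiagonal_single,
      Finset.sum_map]
    obtain ⟨e, he⟩ : ∃ e : ℕ × ℕ → ℤ,
        ∀ p, (u ≤ w → e p = w - p.1) ∧ (w < u → e p = w + p.1) :=
      ⟨fun p => if u ≤ w then w - p.1 else w + p.1, fun p =>
        ⟨fun h => if_pos h, fun h => if_neg (by omega)⟩⟩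
    symm
    refine Finset.sum_of_injOn e ?_ ?_ ?_ ?_
    · rintro ⟨i, j⟩ hp ⟨i', j'⟩ hp' heq
      rw [Finset.mem_coe, Finset.HasAntidiagonal.mem_antidiagonal] at hp hp'
      have h1 := he (i, j)
      have h2 := he (i', j')
      dsimp only at h1 h2 hp hp'
      rw [Prod.mk.injEq]
      omega
    · rintro ⟨i, j⟩ hp
      rw [Finset.mem_coe, Finset.HasAntidiagonal.mem_antidiagonal] at hp
      have h1 := he (i, j)
      dsimp only at h1 hp
      refine hT (Finset.mem_Icc.2 ?_)
      omega
    · intro v hv hn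
      by_contra hne
      obtain ⟨b, hb⟩ := exists_path_of_pathCoeff_ne_zero (left_ne_zero_of_mul hne)
      obtain ⟨c, hc⟩ := exists_path_of_pathCoeff_ne_zero (right_ne_zero_of_mul hne)
      have h3 : u ≤ v ∧ v ≤ w ∨ w ≤ v ∧ v ≤ u := by
        by_cases h1 : u = v
        · omega
        by_cases h2 : v = w
        · omega
        have := (hc.trans hb h1 h2).2.2
        omega
      refine hn ⟨((v - w).natAbs, (u - v).natAbs), ?_, ?_⟩
      · rw [Finset.mem_coe, Finset.HasAntidiagonal.mem_antidiagonal]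
        dsimp only
        omega
      · have h1 := he ((v - w).natAbs, (u - v).natAbs)
        dsimp only at h1
        omega
    · rintro ⟨i, j⟩ hp
      rw [Finset.HasAntidiagonal.mem_antidiagonal] at hp
      have h1 := he (i, j)
      dsimp only at h1 hp
      have hs := ha.split (v := e (i, j)) (by omega)
      rw [pathCoeff_of_path hs.1, pathCoeff_of_path hs.2]
      have e1 : (e (i, j) - w).natAbs = i := by omega
      have e2 : (u - e (i, j)).natAbs = j := by omega
      rw [e1, e2]
      rfl
  · have h0 : C.pathCoeff k (f * g) u w = 0 := by
      by_contra hne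
      exact h (exists_path_of_pathCoeff_ne_zero hne)
    rw [h0]
    refine Finset.sum_eq_zero fun v _ => ?_
    by_contra hne
    obtain ⟨b, hb⟩ := exists_path_of_pathCoeff_ne_zero (left_ne_zero_of_mul hne)
    obtain ⟨c, hc⟩ := exists_path_of_pathCoeff_ne_zero (right_ne_zero_of_mul hne)
    by_cases h1 : u = v
    · exact h ⟨b, h1 ▸ hb⟩
    by_cases h2 : v = w
    · exact h ⟨c, h2 ▸ hc⟩
    exact h ⟨c, (hc.trans hb h1 h2).2.1⟩

theorem mul_act (f g : MvPowerSeries (Fin 2) k) {m : ℤ → k} (hm : m ∈ C.carrier k) :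
    C.act k (f * g) m = C.act k f (C.act k g m) := by
  funext w
  obtain ⟨N, hN⟩ := exists_bound hm w
  set B : ℤ := max N |w| with hB
  have hBN : N ≤ B := le_max_left _ _
  have hBw : |w| ≤ B := le_max_right _ _
  rw [abs_le] at hBw
  have hT : ∀ u a, C.Path a u w → m u ≠ 0 → u ∈ Finset.Icc (-B) B := fun u a hp hu => by
    have := abs_le.1 (hN u a hp hu)
    rw [Finset.mem_Icc]
    omega
  have key : ∀ u v a b, C.Path a u v → m u ≠ 0 → C.Path b v w →
      u ∈ Finset.Icc (-B) B ∧ v ∈ Finset.Icc (-B) B := by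
    intro u v a b h1 hu h2
    by_cases huv : u = v
    · subst huv
      exact ⟨hT u b h2 hu, hT u b h2 hu⟩
    by_cases hvw : v = w
    · subst hvw
      exact ⟨hT u a h1 hu, Finset.mem_Icc.2 hBw⟩
    obtain ⟨-, h3, h4⟩ := h1.trans h2 huv hvw
    have h5 := hT u a h3 hu
    refine ⟨h5, ?_⟩
    rw [Finset.mem_Icc] at h5 ⊢
    omega
  rw [act_eq_sum _ hT, act_eq_sum f (T := Finset.Icc (-B) B) fun v b hp hv => by
    obtain ⟨u, a, h1, hu⟩ := act_ne_zero hv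
    exact (key u v a b h1 hu hp).2]
  have h1 : ∀ v ∈ Finset.Icc (-B) B, C.pathCoeff k f v w * C.act k g m v =
      ∑ u ∈ Finset.Icc (-B) B, C.pathCoeff k f v w * C.pathCoeff k g u v * m u := by
    intro v _
    by_cases h : ∃ b, C.Path b v w
    · obtain ⟨b, hb⟩ := h
      rw [act_eq_sum g (T := Finset.Icc (-B) B) fun u a hp hu => (key u v a b hp hu hb).1,
        Finset.mul_sum]
      simp only [mul_assoc]
    · have h0 : C.pathCoeff k f v w = 0 := by
        by_contra hne
        exact h (exists_path_of_pathCoeff_ne_zero hne)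
      simp [h0]
  rw [Finset.sum_congr rfl h1, Finset.sum_comm]
  refine Finset.sum_congr rfl fun u hu => ?_
  rw [← Finset.sum_mul, pathCoeff_mul]
  intro v hv
  rw [Finset.mem_Icc] at hv hu ⊢
  omega

theorem one_act (m : ℤ → k) : C.act k 1 m = m := by
  funext w
  have h : ∀ u, C.pathCoeff k 1 u w * m u ≠ 0 → u = w := by
    intro u hu
    by_contra hne
    obtain ⟨a, ha⟩ := exists_path_of_pathCoeff_ne_zero (left_ne_zero_of_mul hu)
    refine left_ne_zero_of_mul hu ?_
    classical
    rw [pathCoeff_of_path ha, MvPowerSeries.coeff_one, if_neg]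
    simp
    omega
  rw [act, finsum_eq_single _ w fun u hu => by_contra fun hc => hu (h u hc),
    pathCoeff_of_path (Path.refl C 0 w)]
  simp

theorem zero_act (m : ℤ → k) : C.act k 0 m = 0 := by
  funext w
  simp [act, pathCoeff]

theorem xy_act (m : ℤ → k) :
    C.act k (MvPowerSeries.X 0 * MvPowerSeries.X 1) m = 0 := by
  funext w
  have h : ∀ u, C.pathCoeff k (MvPowerSeries.X 0 * MvPowerSeries.X 1) u w = 0 := by
    intro u
    have h2 : ∀ (a : Fin 2) (n : ℕ), MvPowerSeries.coeff (Finsupp.single a n)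
        (MvPowerSeries.X 0 * MvPowerSeries.X 1 : MvPowerSeries (Fin 2) k) = 0 := by
      intro a n
      rw [MvPowerSeries.X_def, MvPowerSeries.X_def, MvPowerSeries.monomial_mul_monomial,
        MvPowerSeries.coeff_monomial_ne]
      intro he
      have e0 := DFunLike.congr_fun he 0
      have e1 := DFunLike.congr_fun he 1
      fin_cases a <;> simp at e0 e1
    unfold pathCoeff
    split_ifs <;> simp [h2]
  simp [act, h]

end Action

end StringWord

/-- The ring `A = k⟦x, y⟧/(xy)`. -/
abbrev NodeRing (k : Type u) [Field k] : Type u :=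
  MvPowerSeries (Fin 2) k ⧸
    Ideal.span {(MvPowerSeries.X 0 * MvPowerSeries.X 1 : MvPowerSeries (Fin 2) k)}

/-- The string module `M(C)`, for a finite or stabilising string `C`. -/
def StringModule (k : Type u) [Field k] (C : StringWord) : Type u := C.carrier k

noncomputable section

variable (k : Type u) [Field k] (C : StringWord)

instance : AddCommGroup (StringModule k C) := inferInstanceAs (AddCommGroup (C.carrier k))

instance : Module k (StringModule k C) := inferInstanceAs (Module k (C.carrier k))

def StringModule.actionHom :
    MvPowerSeries (Fin 2) k →+* Module.End k (StringModule k C) where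
  toFun f :=
    { toFun := fun m => ⟨C.act k f m.1, StringWord.act_mem f m.2⟩
      map_add' := fun m n => Subtype.ext (StringWord.act_add f m.2 n.2)
      map_smul' := fun c m => Subtype.ext (StringWord.act_smul f c m.1) }
  map_one' := LinearMap.ext fun m => Subtype.ext (StringWord.one_act m.1)
  map_mul' f g := LinearMap.ext fun m => Subtype.ext (StringWord.mul_act f g m.2)
  map_zero' := LinearMap.ext fun m => Subtype.ext (StringWord.zero_act m.1)
  map_add' f g := LinearMap.ext fun m => Subtype.ext (StringWord.add_act f g m.2)

def StringModule.nodeActionHom : NodeRing k →+* Module.End k (StringModule k C) :=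
  Ideal.Quotient.lift _ (StringModule.actionHom k C) fun a ha => by
    have h : Ideal.span {(MvPowerSeries.X 0 * MvPowerSeries.X 1 : MvPowerSeries (Fin 2) k)} ≤
        RingHom.ker (StringModule.actionHom k C) := by
      rw [Ideal.span_le, Set.singleton_subset_iff]
      exact LinearMap.ext fun m => Subtype.ext (StringWord.xy_act m.1)
    exact h ha

instance : Module (NodeRing k) (StringModule k C) :=
  Module.compHom _ (StringModule.nodeActionHom k C)

end

/-! The ring `A` is a noetherian local `k`-algebra with residue field `k`, and `E` can be taken to
be its continuous dual: the `k`-linear functionals on `A` that vanish on a power of the maximal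
ideal. Artin-Rees gives injectivity (`ContDual.injective`), and the augmentation spans an essential
socle. Evaluation at `1` then identifies `Hom_A(M, E)` with the functionals on `M` that are
continuous on every cyclic submodule.

For `M(C)` such functionals come from pairing with `M(C⁻)` by `∑ m_v n_v`. At each infinite end one
of the two families vanishes far out, so the sum is finite. Passing from `C` to `C⁻` reverses paths,
so the action of `A` is self-adjoint. Conversely, continuity on the cyclic module of a vertex at an
outward end forces a functional to kill far tails, and so it is determined by its values on vertices
(`eq_pairing`). This gives `M(C⁻) ≅ M(C)^∨`. The pairing is symmetric, so the isomorphisms for `C`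
and `C⁻` compose to the evaluation map, which proves reflexivity.

For the remaining claim let `U` be generated by the vertices of a large box. It contains the far
vertices of the outward ends, so the dual of `M(C)/U` embeds into the submodule of `M(C⁻)` generated
by the same box. That dual is noetherian, and as `E` is a cogenerator, `M(C)/U` is artinian. -/

/-! ### Uniqueness of injective envelopes -/

section InjectiveEnvelope

variable {R M E E' : Type u} [CommRing R] [AddCommGroup M] [Module R M] [AddCommGroup E]
  [Module R E] [AddCommGroup E'] [Module R E']

/-- Injective envelopes are unique up to isomorphism. -/
theorem IsInjectiveEnvelope.nonempty_linearEquiv {i : M →ₗ[R] E} {j : M →ₗ[R] E'}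
    (hi : IsInjectiveEnvelope i) (hj : IsInjectiveEnvelope j) : Nonempty (E ≃ₗ[R] E') := by
  obtain ⟨h, hh⟩ := hj.injective_module.out i hi.injective j
  have h_inj : Function.Injective h := by
    rw [← LinearMap.ker_eq_bot]
    refine hi.essential _ ((Submodule.eq_bot_iff _).2 ?_)
    rintro _ ⟨hx, ⟨m, rfl⟩⟩
    have h0 : j m = 0 := by rw [← hh]; exact hx
    rw [(map_eq_zero_iff j hj.injective).1 h0, map_zero]
  -- Injectivity of `E` splits `h`. The retraction is injective because `j` is essential, and this
  -- makes `h` surjective.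
  obtain ⟨r, hr⟩ := hi.injective_module.out h h_inj LinearMap.id
  have r_inj : Function.Injective r := by
    rw [← LinearMap.ker_eq_bot]
    refine hj.essential _ ((Submodule.eq_bot_iff _).2 ?_)
    rintro _ ⟨hx, ⟨m, rfl⟩⟩
    have h0 : i m = 0 := by
      have := hr (i m)
      rw [hh] at this
      exact this.symm.trans hx
    rw [(map_eq_zero_iff i hi.injective).1 h0, map_zero]
  exact ⟨LinearEquiv.ofBijective h ⟨h_inj, fun z => ⟨r z, r_inj (hr (r z))⟩⟩⟩

theorem IsInjectiveEnvelope.comp_linearEquiv {M' : Type u} [AddCommGroup M'] [Module R M']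
    {i : M →ₗ[R] E} (hi : IsInjectiveEnvelope i) (e : M' ≃ₗ[R] M) :
    IsInjectiveEnvelope (i ∘ₗ e.toLinearMap) where
  injective_module := hi.injective_module
  injective := hi.injective.comp e.injective
  essential N hN := hi.essential N (by rwa [LinearMap.range_comp_of_range_eq_top _ e.range] at hN)

end InjectiveEnvelope

/-! ### The minimal injective cogenerator -/

section MatlisModule

variable (R : Type u) [CommRing R]

instance MatlisModule.injective : Module.Injective R (MatlisModule R) :=
  (Classical.choose_spec (Classical.choose_spec (exists_isInjectiveEnvelope R
    (DirectSum (MaximalSpectrum R) fun I => R ⧸ I.asIdeal)))).injective_module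

/-- The Matlis module is a cogenerator. -/
theorem MatlisModule.exists_ne_zero {M : Type u} [AddCommGroup M] [Module R M] {m : M}
    (hm : m ≠ 0) : ∃ φ : MatlisDual R M, φ m ≠ 0 := by
  classical
  obtain ⟨i, hi⟩ := Classical.choose_spec (exists_isInjectiveEnvelope R
    (DirectSum (MaximalSpectrum R) fun I => R ⧸ I.asIdeal))
  set J := LinearMap.ker (LinearMap.toSpanSingleton R M m) with hJ
  have hJt : J ≠ ⊤ := by
    intro h
    have : (1 : R) ∈ J := h ▸ Submodule.mem_top
    rw [hJ, LinearMap.mem_ker, LinearMap.toSpanSingleton_apply, one_smul] at this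
    exact hm this
  obtain ⟨P, hP, hJP⟩ := Ideal.exists_le_maximal J hJt
  let I : MaximalSpectrum R := ⟨P, hP⟩
  -- `R ⧸ J` is the cyclic module generated by `m`. It maps onto a simple module inside `E`, and
  -- this map extends to all of `M`.
  let g : R ⧸ J →ₗ[R] MatlisModule R :=
    i ∘ₗ DirectSum.lof R (MaximalSpectrum R) (fun I => R ⧸ I.asIdeal) I ∘ₗ
      Submodule.factor (p := J) (p' := I.asIdeal) hJP
  obtain ⟨φ, hφ⟩ := (MatlisModule.injective R).out
    (J.liftQ (LinearMap.toSpanSingleton R M m) le_rfl)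
    (LinearMap.ker_eq_bot.1 (Submodule.ker_liftQ_eq_bot _ _ _ le_rfl)) g
  refine ⟨φ, fun h0 => ?_⟩
  have h1 := hφ (J.mkQ 1)
  rw [Submodule.mkQ_apply, Submodule.liftQ_apply, LinearMap.toSpanSingleton_apply, one_smul,
    h0] at h1
  have h2 : Submodule.factor (p := J) (p' := I.asIdeal) hJP (Submodule.Quotient.mk 1) = 0 :=
    DirectSum.of_injective (β := fun I : MaximalSpectrum R => R ⧸ I.asIdeal) I
      (hi.injective (by
        refine h1.symm.trans ?_
        rw [map_zero, map_zero]))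
  have h3 : (1 : R) ∈ P := (Submodule.Quotient.mk_eq_zero I.asIdeal).1 h2
  exact hP.ne_top ((Ideal.eq_top_iff_one _).2 h3)

/-- Annihilators in the dual reverse strict inclusions: an element outside `N` is detected by a
functional on `M ⧸ N`, since `E` is a cogenerator. A strictly descending chain in `M` thus yields a
strictly ascending one in the dual. -/
theorem isArtinian_of_isNoetherian_matlisDual (M : Type u) [AddCommGroup M] [Module R M]
    [IsNoetherian R (MatlisDual R M)] : IsArtinian R M := by
  let F : Submodule R M → Submodule R (MatlisDual R M) := fun N =>
    LinearMap.ker (LinearMap.lcomp R (MatlisModule R) N.subtype)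
  have hF : ∀ N φ, φ ∈ F N ↔ ∀ x ∈ N, φ x = 0 := fun N φ => by
    simp only [F, LinearMap.mem_ker]
    exact ⟨fun h x hx => LinearMap.congr_fun h ⟨x, hx⟩, fun h => LinearMap.ext fun x => h x x.2⟩
  have hanti : StrictAnti F := by
    intro N N' hlt
    refine lt_of_le_of_ne (fun φ h => (hF _ _).2 fun x hx => (hF _ _).1 h x (hlt.le hx)) ?_
    intro heq
    obtain ⟨m, hm', hm⟩ := Set.exists_of_ssubset hlt
    obtain ⟨φ, hφ⟩ := MatlisModule.exists_ne_zero R (M := M ⧸ N) (m := N.mkQ m)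
      (by simpa using hm)
    have h1 : φ ∘ₗ N.mkQ ∈ F N := (hF _ _).2 fun x hx => by
      have : N.mkQ x = 0 := by simpa using hx
      rw [LinearMap.comp_apply, this, map_zero]
    rw [← heq] at h1
    exact hφ ((hF _ _).1 h1 m hm')
  exact hanti.wellFoundedLT

/-- Over a local ring the Matlis module is the injective envelope of the residue field. -/
theorem exists_isInjectiveEnvelope_matlisModule [IsLocalRing R] :
    ∃ i : (R ⧸ IsLocalRing.maximalIdeal R) →ₗ[R] MatlisModule R, IsInjectiveEnvelope i := by
  classical
  obtain ⟨i, hi⟩ := Classical.choose_spec (exists_isInjectiveEnvelope R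
    (DirectSum (MaximalSpectrum R) fun I => R ⧸ I.asIdeal))
  let I : MaximalSpectrum R := ⟨IsLocalRing.maximalIdeal R, inferInstance⟩
  have hI : ∀ J, J = I := fun J =>
    MaximalSpectrum.ext (IsLocalRing.eq_maximalIdeal J.isMaximal)
  refine ⟨_, hi.comp_linearEquiv (LinearEquiv.ofBijective
    (DirectSum.lof R (MaximalSpectrum R) (fun I => R ⧸ I.asIdeal) I)
    ⟨DirectSum.of_injective (β := fun I : MaximalSpectrum R => R ⧸ I.asIdeal) I, fun x => ?_⟩)⟩
  induction x using DirectSum.induction_on with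
  | zero => exact ⟨0, map_zero _⟩
  | of J x =>
    obtain rfl := hI J
    exact ⟨x, rfl⟩
  | add x y hx hy =>
    obtain ⟨a, rfl⟩ := hx
    obtain ⟨b, rfl⟩ := hy
    exact ⟨a + b, map_add _ _ _⟩

end MatlisModule

/-! ### The continuous dual as a model of the Matlis module -/

section ContDual

variable (k A : Type u) [Field k] [CommRing A] [Algebra k A]

/-- The `k`-linear dual of a `k`-algebra `A`, as an `A`-module. -/
def AlgDual : Type u := A →ₗ[k] k

noncomputable instance : AddCommGroup (AlgDual k A) := inferInstanceAs (AddCommGroup (A →ₗ[k] k))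

instance : FunLike (AlgDual k A) A k := inferInstanceAs (FunLike (A →ₗ[k] k) A k)

instance : LinearMapClass (AlgDual k A) k A k :=
  inferInstanceAs (LinearMapClass (A →ₗ[k] k) k A k)

variable {k A} in
@[ext]
theorem AlgDual.ext {φ ψ : AlgDual k A} (h : ∀ x, φ x = ψ x) : φ = ψ := LinearMap.ext h

noncomputable instance : Module A (AlgDual k A) where
  smul f φ := LinearMap.comp (show A →ₗ[k] k from φ) (LinearMap.mulLeft k f)
  one_smul φ := AlgDual.ext fun x => congrArg φ (one_mul x)
  mul_smul f g φ := AlgDual.ext fun x => congrArg φ (by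
    simp only [LinearMap.mulLeft_apply]
    ring)
  smul_zero f := rfl
  smul_add f φ ψ := rfl
  add_smul f g φ := AlgDual.ext fun x => (congrArg φ (add_mul f g x)).trans (map_add φ _ _)
  zero_smul φ := AlgDual.ext fun x => (congrArg φ (zero_mul x)).trans (map_zero φ)

variable {k A}

theorem AlgDual.add_apply (φ ψ : AlgDual k A) (x : A) : (φ + ψ) x = φ x + ψ x := rfl

variable (k) in
/-- The `I`-adically continuous linear functionals on `A`. -/
noncomputable def ContDual (I : Ideal A) : Submodule A (AlgDual k A) where
  carrier := {φ | ∃ n, ∀ f ∈ I ^ n, φ f = 0}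
  zero_mem' := ⟨0, fun _ _ => rfl⟩
  add_mem' := by
    rintro φ ψ ⟨n, hn⟩ ⟨p, hp⟩
    refine ⟨max n p, fun f hf => ?_⟩
    rw [AlgDual.add_apply, hn f (Ideal.pow_le_pow_right (le_max_left _ _) hf),
      hp f (Ideal.pow_le_pow_right (le_max_right _ _) hf), add_zero]
  smul_mem' := by
    rintro g φ ⟨n, hn⟩
    exact ⟨n, fun f hf => hn _ (Ideal.mul_mem_left _ _ hf)⟩

/-- By `A`-linearity a homomorphism into the continuous dual is determined by its values at `1`;
this is coinduction, with a continuity condition. -/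
theorem apply_eq_apply_smul {M : Type u} [AddCommGroup M] [Module A M] {I : Ideal A}
    (φ : M →ₗ[A] ContDual k I) (m : M) (f : A) :
    (φ m).1 f = (φ (f • m)).1 1 := by
  rw [map_smul]
  change _ = (φ m).1 (f * 1)
  rw [mul_one]

section Functional

variable {M : Type u} [AddCommGroup M] [Module A M] [Module k M] [IsScalarTower k A M]

/-- A linear functional on a module which is `I`-adically continuous on all cyclic submodules. -/
def IsLocallyContinuous (I : Ideal A) (l : M →ₗ[k] k) : Prop :=
  ∀ m, ∃ n, ∀ f ∈ I ^ n, l (f • m) = 0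

/-- The homomorphism to the continuous dual which belongs to a functional. -/
noncomputable def homOfFunctional (I : Ideal A) (l : M →ₗ[k] k) (hl : IsLocallyContinuous I l) :
    M →ₗ[A] ContDual k I where
  toFun m := ⟨l ∘ₗ ((LinearMap.toSpanSingleton A M m).restrictScalars k), hl m⟩
  map_add' m n := Subtype.ext (AlgDual.ext fun f =>
    (congrArg l (smul_add f m n)).trans (map_add l _ _))
  map_smul' g m := Subtype.ext (AlgDual.ext fun f => congrArg l (by
    simp only [LinearMap.coe_restrictScalars, LinearMap.toSpanSingleton_apply, RingHom.id_apply,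
      LinearMap.mulLeft_apply]
    rw [smul_smul, mul_comm]))

/-- The functional which belongs to a homomorphism to the continuous dual. -/
noncomputable def functionalOfHom {I : Ideal A} (φ : M →ₗ[A] ContDual k I) : M →ₗ[k] k where
  toFun m := (φ m).1 1
  map_add' m n := by rw [map_add]; rfl
  map_smul' c m := by
    rw [← algebraMap_smul A c m, ← apply_eq_apply_smul, Algebra.algebraMap_eq_smul_one, map_smul]
    rfl

theorem functionalOfHom_apply {I : Ideal A} (φ : M →ₗ[A] ContDual k I) (m : M) :
    functionalOfHom φ m = (φ m).1 1 := rfl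

theorem isLocallyContinuous_functionalOfHom {I : Ideal A} (φ : M →ₗ[A] ContDual k I) :
    IsLocallyContinuous I (functionalOfHom φ) := fun m => by
  obtain ⟨n, hn⟩ := (φ m).2
  exact ⟨n, fun f hf => (apply_eq_apply_smul φ m f).symm.trans (hn f hf)⟩

end Functional

/-- The continuous dual of a noetherian algebra is injective. -/
theorem ContDual.injective [IsNoetherianRing A] (I : Ideal A) :
    Module.Injective A (ContDual k I) := by
  refine Module.Baer.injective fun J g => ?_
  -- `J` is finitely generated, so a single power of `I` kills the image of `g`.
  obtain ⟨n, hn⟩ : ∃ n, ∀ x : J, ∀ f ∈ I ^ n, f • g x = 0 := by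
    obtain ⟨s, hs⟩ := (inferInstance : Module.Finite A J)
    have h1 : ∀ x : J, ∃ n, ∀ f ∈ I ^ n, f • g x = 0 := fun x => by
      obtain ⟨n, hn⟩ := (g x).2
      exact ⟨n, fun f hf => Subtype.ext (AlgDual.ext fun h =>
        hn _ (Ideal.mul_mem_right _ _ hf))⟩
    choose N hN using h1
    refine ⟨s.sup N, fun x f hf => ?_⟩
    have hx : x ∈ Submodule.span A (s : Set J) := hs ▸ Submodule.mem_top
    induction hx using Submodule.span_induction with
    | mem x hx => exact hN x f (Ideal.pow_le_pow_right (Finset.le_sup hx) hf)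
    | zero => rw [map_zero, smul_zero]
    | add x y _ _ hx hy => rw [map_add, smul_add, hx, hy, add_zero]
    | smul a x _ hx => rw [map_smul, smul_comm, hx, smul_zero]
  -- Artin-Rees puts `I ^ (n + p) ⊓ J` inside `I ^ n • J`, where the functional of `g` vanishes.
  obtain ⟨p, hp⟩ := I.exists_pow_inf_eq_pow_smul J
  have hAR : ∀ x : J, (x : A) ∈ I ^ (n + p) → functionalOfHom g x = 0 := by
    intro x hx
    have h1 : (x : A) ∈ I ^ (n + p) • (⊤ : Submodule A A) ⊓ J := ⟨by simpa using hx, x.2⟩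
    rw [hp _ (Nat.le_add_left _ _), Nat.add_sub_cancel] at h1
    have h2 : (x : A) ∈ I ^ n • J := Submodule.smul_mono le_rfl inf_le_right h1
    obtain ⟨_, h3⟩ : ∃ hx : (x : A) ∈ J, functionalOfHom g ⟨x, hx⟩ = 0 := by
      refine Submodule.smul_induction_on h2 (fun f hf y hy => ?_) ?_
      · refine ⟨J.smul_mem f hy, ?_⟩
        rw [functionalOfHom_apply, show (⟨f • y, J.smul_mem f hy⟩ : J) = f • ⟨y, hy⟩ from rfl,
          map_smul, hn _ f hf]
        rfl
      · rintro y z ⟨hy, hy'⟩ ⟨hz, hz'⟩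
        refine ⟨J.add_mem hy hz, ?_⟩
        rw [show (⟨y + z, J.add_mem hy hz⟩ : J) = ⟨y, hy⟩ + ⟨z, hz⟩ from rfl, map_add, hy', hz',
          add_zero]
    exact h3
  let q : J →ₗ[k] A ⧸ I ^ (n + p) :=
    (((I ^ (n + p)).mkQ ∘ₗ J.subtype).restrictScalars k)
  -- The functional vanishes on the kernel of `q`, so it extends `k`-linearly to `A ⧸ I ^ (n + p)`.
  -- Factoring through this quotient makes the extension continuous.
  have hμ : functionalOfHom g ∈ LinearMap.range q.dualMap := by
    rw [LinearMap.range_dualMap_eq_dualAnnihilator_ker, Submodule.mem_dualAnnihilator]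
    intro x hx
    exact hAR x ((Submodule.Quotient.mk_eq_zero _).1 hx)
  obtain ⟨μ, hμ⟩ := hμ
  let ψ : ContDual k I := ⟨μ ∘ₗ ((I ^ (n + p)).mkQ.restrictScalars k), n + p, fun f hf => by
    change μ ((I ^ (n + p)).mkQ f) = 0
    rw [show (I ^ (n + p)).mkQ f = 0 from (Submodule.Quotient.mk_eq_zero _).2 hf,
      map_zero]⟩
  refine ⟨LinearMap.toSpanSingleton A _ ψ, fun x hx => Subtype.ext (AlgDual.ext fun f => ?_)⟩
  rw [apply_eq_apply_smul g, ← functionalOfHom_apply g, ← hμ]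
  change μ ((I ^ (n + p)).mkQ (x * f)) = μ ((I ^ (n + p)).mkQ (f * x))
  rw [mul_comm]

/-- The continuous dual with respect to the kernel of an augmentation is an injective envelope. -/
theorem exists_isInjectiveEnvelope_contDual [IsNoetherianRing A] (ε : A →ₐ[k] k) (I : Ideal A)
    (hI : ∀ f, f ∈ I ↔ ε f = 0) :
    ∃ i : (A ⧸ I) →ₗ[A] ContDual k I, IsInjectiveEnvelope i := by
  let e : ContDual k I := ⟨ε.toLinearMap, 1, fun f hf => (hI f).1 (by simpa using hf)⟩
  have he : ∀ f g, (f • e).1 g = ε f * ε g := fun f g => map_mul ε f g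
  have hker : LinearMap.ker (LinearMap.toSpanSingleton A _ e) = I := by
    ext f
    rw [LinearMap.mem_ker, LinearMap.toSpanSingleton_apply, hI]
    constructor
    · intro h
      have := he f 1
      rw [h, map_one ε, mul_one] at this
      exact this.symm
    · intro h
      exact Subtype.ext (AlgDual.ext fun g => by rw [he, h, zero_mul]; rfl)
  refine ⟨I.liftQ (LinearMap.toSpanSingleton A _ e) hker.ge, ContDual.injective I,
    LinearMap.ker_eq_bot.1 (Submodule.ker_liftQ_eq_bot _ _ _ hker.le), fun N hN => ?_⟩
  rw [Submodule.eq_bot_iff]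
  intro φ hφ
  by_contra hne
  classical
  -- At the least power of `I` killing `φ`, the preceding power contains an `f` such that `f • φ` is
  -- nonzero and killed by `I`.
  have hex : ∃ n, ∀ f ∈ I ^ n, f • φ = 0 := by
    obtain ⟨n, hn⟩ := φ.2
    exact ⟨n, fun f hf => Subtype.ext (AlgDual.ext fun h => hn _ (Ideal.mul_mem_right _ _ hf))⟩
  obtain ⟨n, hn⟩ : ∃ n, Nat.find hex = n + 1 := Nat.exists_eq_succ_of_ne_zero fun h0 => hne (by
    have := Nat.find_spec hex 1 (by simp [h0])
    rwa [one_smul] at this)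
  have h1 := Nat.find_min hex (m := n) (by omega)
  push Not at h1
  obtain ⟨f, hf, hfφ⟩ := h1
  have h2 : ∀ g ∈ I, g • f • φ = 0 := fun g hg => by
    rw [smul_smul]
    refine Nat.find_spec hex _ ?_
    rw [hn, pow_succ, mul_comm g]
    exact Ideal.mul_mem_mul hf hg
  -- A functional killed by `I` depends only on `ε g`, so it is a scalar multiple of the
  -- augmentation.
  have h3 : algebraMap k A (φ.1 f) • e = f • φ := Subtype.ext (AlgDual.ext fun g => by
    rw [he, AlgHom.commutes]
    have h4 := h2 (g - algebraMap k A (ε g)) ((hI _).2 (by simp))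
    rw [sub_smul, sub_eq_zero] at h4
    have h5 := congrArg (fun ψ : ContDual k I => ψ.1 1) h4
    change φ.1 (f * (g * 1)) = φ.1 (f * (algebraMap k A (ε g) * 1)) at h5
    change _ = φ.1 (f * g)
    rw [mul_one, mul_one] at h5
    rw [h5, mul_comm f, ← Algebra.smul_def (ε g) f, map_smul, smul_eq_mul]
    exact mul_comm _ _)
  refine hfφ ((Submodule.eq_bot_iff _).1 hN _ ⟨N.smul_mem f hφ, ?_⟩)
  exact ⟨Submodule.Quotient.mk (algebraMap k A (φ.1 f)), h3⟩

/-- Both sides are injective envelopes of the residue field, because the kernel of the augmentation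
is the maximal ideal. -/
theorem nonempty_matlisModule_linearEquiv [IsNoetherianRing A] [IsLocalRing A] (ε : A →ₐ[k] k) :
    Nonempty (MatlisModule A ≃ₗ[A] ContDual k (RingHom.ker ε)) := by
  have hm : RingHom.ker ε = IsLocalRing.maximalIdeal A :=
    IsLocalRing.eq_maximalIdeal (RingHom.ker_isMaximal_of_surjective ε fun c =>
      ⟨algebraMap k A c, by simp⟩)
  obtain ⟨i, hi⟩ : ∃ i : (A ⧸ RingHom.ker ε) →ₗ[A] MatlisModule A, IsInjectiveEnvelope i :=
    hm ▸ exists_isInjectiveEnvelope_matlisModule A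
  obtain ⟨j, hj⟩ := exists_isInjectiveEnvelope_contDual ε (RingHom.ker ε) fun f => Iff.rfl
  exact hi.nonempty_linearEquiv hj

end ContDual

/-! ### The two branches of the node and powers of its maximal ideal -/

namespace NodeRing

variable {k : Type u} [Field k]

variable (k) in
/-- The homomorphism `k⟦x, y⟧ → k⟦t⟧` which sends the variable `a` to `t` and the other one
to `0`. -/
noncomputable def seriesBranch (a : Fin 2) : MvPowerSeries (Fin 2) k →ₐ[k] PowerSeries k where
  toFun f := PowerSeries.mk fun j => MvPowerSeries.coeff (Finsupp.single a j) f
  map_one' := by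
    classical
    ext j
    rw [PowerSeries.coeff_mk, MvPowerSeries.coeff_one, PowerSeries.coeff_one]
    simp
  map_mul' f g := by
    ext j
    rw [PowerSeries.coeff_mk, MvPowerSeries.coeff_mul, PowerSeries.coeff_mul,
      Finsupp.antidiagonal_single, Finset.sum_map]
    simp [PowerSeries.coeff_mk]
  map_zero' := by
    ext j
    simp
  map_add' f g := by
    ext j
    simp
  commutes' c := by
    classical
    ext j
    rw [PowerSeries.coeff_mk, MvPowerSeries.algebraMap_apply, MvPowerSeries.coeff_C,
      PowerSeries.algebraMap_apply, PowerSeries.coeff_C]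
    simp

theorem coeff_seriesBranch (a : Fin 2) (f : MvPowerSeries (Fin 2) k) (j : ℕ) :
    PowerSeries.coeff j (seriesBranch k a f) = MvPowerSeries.coeff (Finsupp.single a j) f :=
  PowerSeries.coeff_mk j fun j => MvPowerSeries.coeff (Finsupp.single a j) f

theorem seriesBranch_X (a b : Fin 2) :
    seriesBranch k a (MvPowerSeries.X b) = if a = b then PowerSeries.X else 0 := by
  classical
  ext j
  rw [coeff_seriesBranch, MvPowerSeries.coeff_X]
  by_cases h : a = b
  · subst h
    rw [if_pos rfl, PowerSeries.coeff_X]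
    by_cases hj : j = 1 <;> simp [hj, (Finsupp.single_injective a).eq_iff]
  · rw [if_neg h, if_neg, map_zero]
    intro he
    have := DFunLike.congr_fun he b
    simp [h] at this

variable (k) in
/-- The projection of `k⟦x, y⟧/(xy)` to the branch with the coordinate `a`. -/
noncomputable def branch (a : Fin 2) : NodeRing k →ₐ[k] PowerSeries k :=
  Ideal.Quotient.liftₐ _ (seriesBranch k a) fun f hf => by
    have h : Ideal.span {(MvPowerSeries.X 0 * MvPowerSeries.X 1 : MvPowerSeries (Fin 2) k)} ≤
        RingHom.ker (seriesBranch k a) := by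
      rw [Ideal.span_le, Set.singleton_subset_iff, SetLike.mem_coe, RingHom.mem_ker, map_mul,
        seriesBranch_X, seriesBranch_X]
      fin_cases a <;> simp
    exact h hf

theorem branch_mk (a : Fin 2) (f : MvPowerSeries (Fin 2) k) :
    branch k a (Ideal.Quotient.mk _ f) = seriesBranch k a f := rfl

variable (k) in
/-- The augmentation of `k⟦x, y⟧/(xy)`, i.e. the constant coefficient. -/
noncomputable def augmentation : NodeRing k →ₐ[k] k :=
  AlgHom.ofLinearMap
    ((PowerSeries.coeff 0).restrictScalars k ∘ₗ (branch k 0).toLinearMap) (by simp) (by simp)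

theorem augmentation_mk (f : MvPowerSeries (Fin 2) k) :
    augmentation k (Ideal.Quotient.mk _ f) = MvPowerSeries.constantCoeff f := by
  change PowerSeries.coeff 0 (seriesBranch k 0 f) = _
  rw [coeff_seriesBranch, Finsupp.single_zero]
  rfl

instance : Nontrivial (NodeRing k) := (augmentation k).toRingHom.domain_nontrivial

instance : IsLocalRing (NodeRing k) :=
  IsLocalRing.of_surjective' (Ideal.Quotient.mk _) Ideal.Quotient.mk_surjective

variable (k) in
/-- The maximal ideal of `k⟦x, y⟧/(xy)`. -/
noncomputable abbrev maxIdeal : Ideal (NodeRing k) := RingHom.ker (augmentation k)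

theorem mk_X_mem_maxIdeal (a : Fin 2) :
    Ideal.Quotient.mk _ (MvPowerSeries.X a : MvPowerSeries (Fin 2) k) ∈ maxIdeal k := by
  rw [RingHom.mem_ker]
  exact (augmentation_mk _).trans (MvPowerSeries.constantCoeff_X a)

/-- Each branch sends the maximal ideal into `(t)`, hence its `n`-th power into `(t ^ n)`. -/
theorem coeff_eq_zero_of_mk_mem_pow {f : MvPowerSeries (Fin 2) k} {n : ℕ}
    (hf : Ideal.Quotient.mk _ f ∈ maxIdeal k ^ n) (a : Fin 2) {j : ℕ} (hj : j < n) :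
    MvPowerSeries.coeff (Finsupp.single a j) f = 0 := by
  have h1 : maxIdeal k ≤ (Ideal.span {(PowerSeries.X : PowerSeries k)}).comap (branch k a) := by
    intro g hg
    obtain ⟨g, rfl⟩ := Ideal.Quotient.mk_surjective g
    rw [Ideal.mem_comap, Ideal.mem_span_singleton, PowerSeries.X_dvd_iff, branch_mk,
      ← PowerSeries.coeff_zero_eq_constantCoeff_apply, coeff_seriesBranch, Finsupp.single_zero]
    exact (augmentation_mk g).symm.trans hg
  have h2 := Ideal.le_comap_pow (branch k a) n (Ideal.pow_right_mono h1 n hf)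
  rw [Ideal.mem_comap, Ideal.span_singleton_pow, Ideal.mem_span_singleton,
    PowerSeries.X_pow_dvd_iff] at h2
  rw [← coeff_seriesBranch, ← branch_mk]
  exact h2 j hj

theorem mk_mem_maxIdeal_pow {f : MvPowerSeries (Fin 2) k} {n : ℕ} (a : Fin 2)
    (hf : ∀ d : Fin 2 →₀ ℕ, d a < n → MvPowerSeries.coeff d f = 0) :
    Ideal.Quotient.mk _ f ∈ maxIdeal k ^ n := by
  obtain ⟨g, rfl⟩ := MvPowerSeries.X_pow_dvd_iff.2 hf
  rw [map_mul, map_pow]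
  exact Ideal.mul_mem_right _ _ (Ideal.pow_mem_pow (mk_X_mem_maxIdeal a) n)

end NodeRing

/-! ### Inverse strings and ultimate constancy -/

namespace StringWord

variable {C D : StringWord}

theorem letter_invert (C : StringWord) (i : ℤ) :
    C.invert.letter i = (C.letter i).map StringLetter.flip := rfl

theorem _root_.StringLetter.flip_flip (a : StringLetter) : a.flip.flip = a := by
  cases a <;> rfl

theorem letter_eq_iff_invert {C : StringWord} {i : ℤ} {b : StringLetter} :
    C.letter i = some b ↔ C.invert.letter i = some b.flip := by
  rw [letter_invert, Option.map_eq_some_iff]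
  constructor
  · exact fun h => ⟨b, h, rfl⟩
  · rintro ⟨c, hc, hcb⟩
    rw [hc, ← c.flip_flip, hcb, b.flip_flip]

/-- With `D` a separate string, constructions for the pair `C`, `D` apply again with the roles
exchanged, and no module over the doubly inverted string appears. -/
theorem invert_eq_comm (h : C.invert = D) : D.invert = C := by
  subst h
  cases C with
  | mk l _ _ _ =>
    simp only [invert, mk.injEq]
    funext i
    cases l i <;> simp [StringLetter.flip_flip]

theorem support_invert (C : StringWord) : C.invert.support = C.support := by
  ext i
  simp [support, letter_invert]

theorem vertices_invert (C : StringWord) : C.invert.vertices = C.vertices := by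
  simp only [vertices, support_invert]

theorem path_invert {a : Fin 2} {u w : ℤ} : C.invert.Path a w u ↔ C.Path a u w := by
  have h1 : ∀ i, C.letter i = some (.dir a) ↔ C.invert.letter i = some (.inv a) :=
    fun i => letter_eq_iff_invert
  have h2 : ∀ i, C.letter i = some (.inv a) ↔ C.invert.letter i = some (.dir a) :=
    fun i => letter_eq_iff_invert
  simp only [Path, h1, h2]
  exact or_comm

/-- The letters of `C` are constant outside of `(-N, N)`. -/
structure IsConstantBeyond (C : StringWord) (N : ℤ) : Prop where
  nonneg : 0 ≤ N
  right : ∃ c, ∀ i ≥ N, C.letter i = c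
  left : ∃ c, ∀ i ≤ -N, C.letter i = c

theorem IsConstantBeyond.invert {N : ℤ} (h : C.IsConstantBeyond N) :
    C.invert.IsConstantBeyond N where
  nonneg := h.nonneg
  right := by
    obtain ⟨c, hc⟩ := h.right
    exact ⟨_, fun i hi => congrArg (Option.map StringLetter.flip) (hc i hi)⟩
  left := by
    obtain ⟨c, hc⟩ := h.left
    exact ⟨_, fun i hi => congrArg (Option.map StringLetter.flip) (hc i hi)⟩

theorem letter_eq_none {i : ℤ} (h : i ∉ C.support) : C.letter i = none := by
  simpa [support] using h

/-- The support is an interval. Either it is bounded above and the constant is `none`, or it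
contains all large integers and stabilisation propagates one letter. -/
theorem exists_constant_right {N : ℤ} (hN : ∀ i : ℤ, N ≤ |i| → i ∈ C.support → i + 1 ∈ C.support →
    C.letter i = C.letter (i + 1)) : ∃ R, ∃ c, ∀ i ≥ R, C.letter i = c := by
  by_cases hb : BddAbove C.support
  · obtain ⟨b, hb⟩ := hb
    refine ⟨b + 1, none, fun i hi => letter_eq_none fun h => ?_⟩
    have := hb h
    omega
  · rw [not_bddAbove_iff] at hb
    obtain ⟨i₀, h₀, hi₀⟩ := hb |N|
    have hs : ∀ i ≥ i₀, i ∈ C.support := fun i hi => by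
      obtain ⟨j, hj, hij⟩ := hb i
      exact C.ordConnected.out h₀ hj ⟨hi, hij.le⟩
    refine ⟨i₀, C.letter i₀, fun i hi => ?_⟩
    induction i, hi using Int.leInduction with
    | base => rfl
    | succ i hi ih =>
      rw [← ih, hN i _ (hs i hi) (hs _ (by omega))]
      have := le_abs_self N
      have := le_abs_self i
      omega

theorem exists_constant_left {N : ℤ} (hN : ∀ i : ℤ, N ≤ |i| → i ∈ C.support → i + 1 ∈ C.support →
    C.letter i = C.letter (i + 1)) : ∃ R, ∃ c, ∀ i ≤ R, C.letter i = c := by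
  by_cases hb : BddBelow C.support
  · obtain ⟨b, hb⟩ := hb
    refine ⟨b - 1, none, fun i hi => letter_eq_none fun h => ?_⟩
    have := hb h
    omega
  · rw [not_bddBelow_iff] at hb
    obtain ⟨i₀, h₀, hi₀⟩ := hb (-|N|)
    have hs : ∀ i ≤ i₀, i ∈ C.support := fun i hi => by
      obtain ⟨j, hj, hij⟩ := hb i
      exact C.ordConnected.out hj h₀ ⟨hij.le, hi⟩
    refine ⟨i₀, C.letter i₀, fun i hi => ?_⟩
    induction i, hi using Int.leInductionDown with
    | base => rfl
    | pred i hi ih =>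
      have h1 := hN (i - 1) (by
        have := le_abs_self N
        have := neg_le_abs (i - 1)
        omega) (hs _ (by omega)) (by simpa using hs i hi)
      rw [h1, sub_add_cancel, ih]

theorem exists_isConstantBeyond (hC : C.IsFinite ∨ C.IsStabilising) :
    ∃ N, C.IsConstantBeyond N := by
  obtain ⟨N, hN⟩ : ∃ N : ℤ, ∀ i : ℤ, N ≤ |i| → i ∈ C.support → i + 1 ∈ C.support →
      C.letter i = C.letter (i + 1) := by
    rcases hC with h | ⟨-, h⟩
    · have h' : C.support.Finite := h
      obtain ⟨a, ha⟩ := h'.bddAbove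
      obtain ⟨b, hb⟩ := h'.bddBelow
      -- Beyond both bounds of the support the condition is vacuous.
      refine ⟨max (|a| + 1) (|b| + 1), fun i hi hs => ?_⟩
      have h1 := ha hs
      have h2 := hb hs
      have h3 := le_max_left (|a| + 1) (|b| + 1)
      have h4 := le_max_right (|a| + 1) (|b| + 1)
      have h5 := le_abs_self a
      have h6 := neg_abs_le b
      rcases abs_choice i with h7 | h7 <;> omega
    · exact h
  obtain ⟨R, c, hc⟩ := exists_constant_right hN
  obtain ⟨L, d, hd⟩ := exists_constant_left hN
  have h1 := le_abs_self R
  have h2 := neg_abs_le L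
  have h3 := abs_nonneg R
  have h4 := abs_nonneg L
  exact ⟨|R| + |L|, by omega, ⟨c, fun i hi => hc i (by omega)⟩, ⟨d, fun i hi => hd i (by omega)⟩⟩

/-- Nonnegativity of `N` accounts for the empty word, whose only vertex is `0`. -/
theorem le_of_mem_vertices {N : ℤ} (h0 : 0 ≤ N) (hN : ∀ i ≥ N, C.letter i = none) {v : ℤ}
    (hv : v ∈ C.vertices) : v ≤ N := by
  by_contra hlt
  rcases hv with h | h | ⟨-, rfl⟩
  · simp [support, hN v (by omega)] at h
  · simp [support, hN (v + 1) (by omega)] at h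
  · omega

theorem ge_of_mem_vertices {N : ℤ} (h0 : 0 ≤ N) (hN : ∀ i ≤ -N, C.letter i = none) {v : ℤ}
    (hv : v ∈ C.vertices) : -N ≤ v := by
  by_contra hlt
  rcases hv with h | h | ⟨-, rfl⟩
  · simp [support, hN v (by omega)] at h
  · simp [support, hN (v + 1) (by omega)] at h
  · omega

/-! ### The pairing between families on a string and on its inverse -/

section Pairing

variable {k : Type u} [Field k]

theorem mem_vertices_of_ne_zero {m : ℤ → k} (hm : m ∈ C.carrier k) {v : ℤ} (h : m v ≠ 0) :
    v ∈ C.vertices := by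
  by_contra hv
  exact h (hm.1 v hv)

theorem pathCoeff_invert (f : MvPowerSeries (Fin 2) k) (u w : ℤ) :
    C.invert.pathCoeff k f w u = C.pathCoeff k f u w := by
  unfold pathCoeff
  rw [propext (path_invert (C := C) (a := 0)), propext (path_invert (C := C) (a := 1))]
  rw [show (w - u).natAbs = (u - w).natAbs by omega]

theorem pathCoeff_smul (c : k) (f : MvPowerSeries (Fin 2) k) (u w : ℤ) :
    C.pathCoeff k (c • f) u w = c * C.pathCoeff k f u w := by
  unfold pathCoeff
  split_ifs <;> simp

/-- For a series `m` in `M(C)` and a series `n` in `M(C⁻)`, the paths from the support of `m` to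
the support of `n` stay in a finite part of the diagram. -/
theorem IsConstantBeyond.exists_pair_bound {N : ℤ} (hC : C.IsConstantBeyond N) {m n : ℤ → k}
    (hm : m ∈ C.carrier k) (hn : n ∈ C.invert.carrier k) :
    ∃ B : ℤ, ∀ u w a, C.Path a u w → m u ≠ 0 → n w ≠ 0 →
      u ∈ Finset.Icc (-B) B ∧ w ∈ Finset.Icc (-B) B := by
  have hvm : ∀ {v}, m v ≠ 0 → v ∈ C.vertices := mem_vertices_of_ne_zero hm
  have hvn : ∀ {v}, n v ≠ 0 → v ∈ C.vertices := fun h =>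
    vertices_invert C ▸ mem_vertices_of_ne_zero hn h
  have hR : ∃ B : ℤ, ∀ u w a, C.Path a u w → m u ≠ 0 → n w ≠ 0 → u ≤ B ∧ w ≤ B := by
    obtain ⟨c, hc⟩ := hC.right
    rcases c with _ | b | b
    · exact ⟨N, fun u w a _ hu hw => ⟨le_of_mem_vertices hC.nonneg hc (hvm hu),
        le_of_mem_vertices hC.nonneg hc (hvn hw)⟩⟩
    -- At an inward end `m` vanishes far out, and no path leads outward beyond `N`. In the next case
    -- the end is inward for `C⁻`, and `n` and `w` take over the roles of `m` and `u`.
    · obtain ⟨N', hN'⟩ := hm.2.2 ⟨N, fun i hi => ⟨b, hc i hi⟩⟩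
      refine ⟨max N N', fun u w a hp hu _ => ?_⟩
      have h1 : u < N' := lt_of_not_ge fun h => hu (hN' u h)
      refine ⟨by omega, ?_⟩
      rcases hp with ⟨hp, -⟩ | ⟨l, hp⟩
      · omega
      · by_contra hlt
        have := hp w (by omega) le_rfl
        simp [hc w (by omega)] at this
    · obtain ⟨N', hN'⟩ := hn.2.2 ⟨N, fun i hi => ⟨b, letter_eq_iff_invert.1 (hc i hi)⟩⟩
      refine ⟨max N N', fun u w a hp _ hw => ?_⟩
      have h1 : w < N' := lt_of_not_ge fun h => hw (hN' w h)
      refine ⟨?_, by omega⟩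
      rcases hp with ⟨l, hp⟩ | ⟨hp, -⟩
      · by_contra hlt
        have := hp u (by omega) le_rfl
        simp [hc u (by omega)] at this
      · omega
  have hL : ∃ B : ℤ, ∀ u w a, C.Path a u w → m u ≠ 0 → n w ≠ 0 → B ≤ u ∧ B ≤ w := by
    obtain ⟨c, hc⟩ := hC.left
    rcases c with _ | b | b
    · exact ⟨-N, fun u w a _ hu hw => ⟨ge_of_mem_vertices hC.nonneg hc (hvm hu),
        ge_of_mem_vertices hC.nonneg hc (hvn hw)⟩⟩
    · obtain ⟨N', hN'⟩ := hn.2.1 ⟨-N, fun i hi => ⟨b, letter_eq_iff_invert.1 (hc i hi)⟩⟩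
      -- The first letter of a path going right from `u` sits at index `u + 1`, so the left-hand
      -- bound is shifted by one.
      refine ⟨min (-N - 1) N', fun u w a hp _ hw => ?_⟩
      have h1 : N' < w := lt_of_not_ge fun h => hw (hN' w h)
      refine ⟨?_, by omega⟩
      rcases hp with ⟨hp, -⟩ | ⟨l, hp⟩
      · omega
      · by_contra hlt
        have := hp (u + 1) (by omega) (by omega)
        simp [hc (u + 1) (by omega)] at this
    · obtain ⟨N', hN'⟩ := hm.2.1 ⟨-N, fun i hi => ⟨b, hc i hi⟩⟩
      refine ⟨min (-N - 1) N', fun u w a hp hu _ => ?_⟩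
      have h1 : N' < u := lt_of_not_ge fun h => hu (hN' u h)
      refine ⟨by omega, ?_⟩
      rcases hp with ⟨l, hp⟩ | ⟨hp, -⟩
      · by_contra hlt
        have := hp (w + 1) (by omega) (by omega)
        simp [hc (w + 1) (by omega)] at this
      · omega
  obtain ⟨B, hB⟩ := hR
  obtain ⟨B', hB'⟩ := hL
  refine ⟨max B (-B'), fun u w a hp hu hw => ?_⟩
  have h1 := hB u w a hp hu hw
  have h2 := hB' u w a hp hu hw
  rw [Finset.mem_Icc, Finset.mem_Icc]
  omega

/-- The pairing `∑_v m_v n_v`. -/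
noncomputable def pairing (m n : ℤ → k) : k := ∑ᶠ v, m v * n v

theorem pairing_comm (m n : ℤ → k) : pairing m n = pairing n m :=
  finsum_congr fun _ => mul_comm _ _

theorem pairing_eq_sum {m n : ℤ → k} {T : Finset ℤ} (h : ∀ v, m v ≠ 0 → n v ≠ 0 → v ∈ T) :
    pairing m n = ∑ v ∈ T, m v * n v :=
  finsum_eq_sum_of_support_subset _ fun v hv =>
    h v (left_ne_zero_of_mul hv) (right_ne_zero_of_mul hv)

theorem pairing_act_eq_sum (f : MvPowerSeries (Fin 2) k) {m n : ℤ → k} {T : Finset ℤ}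
    (hT : ∀ u w a, C.Path a u w → m u ≠ 0 → n w ≠ 0 → u ∈ T ∧ w ∈ T) :
    pairing (C.act k f m) n = ∑ w ∈ T, ∑ u ∈ T, C.pathCoeff k f u w * m u * n w := by
  rw [pairing_eq_sum (T := T) fun w h1 h2 => by
    obtain ⟨u, a, hp, hu⟩ := act_ne_zero h1
    exact (hT u w a hp hu h2).2]
  refine Finset.sum_congr rfl fun w _ => ?_
  by_cases hw : n w = 0
  · simp [hw]
  · rw [act_eq_sum f (T := T) fun u a hp hu => (hT u w a hp hu hw).1, Finset.sum_mul]

/-- Reversing paths transposes the matrix of `f`. All relevant paths stay in a finite box, so the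
two sums may be interchanged. -/
theorem IsConstantBeyond.pairing_act {N : ℤ} (hC : C.IsConstantBeyond N)
    (f : MvPowerSeries (Fin 2) k) {m n : ℤ → k} (hm : m ∈ C.carrier k)
    (hn : n ∈ C.invert.carrier k) :
    pairing (C.act k f m) n = pairing m (C.invert.act k f n) := by
  obtain ⟨B, hB⟩ := hC.exists_pair_bound hm hn
  rw [pairing_comm m, pairing_act_eq_sum f hB,
    pairing_act_eq_sum (C := C.invert) f (T := Finset.Icc (-B) B) fun u w a hp hu hw =>
      (hB w u a (path_invert.1 hp) hw hu).symm, Finset.sum_comm]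
  refine Finset.sum_congr rfl fun w _ => Finset.sum_congr rfl fun u _ => ?_
  rw [pathCoeff_invert]
  ring

theorem IsConstantBeyond.exists_pairing_support {N : ℤ} (hC : C.IsConstantBeyond N) {m n : ℤ → k}
    (hm : m ∈ C.carrier k) (hn : n ∈ C.invert.carrier k) :
    ∃ B : ℤ, ∀ v, m v ≠ 0 → n v ≠ 0 → v ∈ Finset.Icc (-B) B := by
  obtain ⟨B, hB⟩ := hC.exists_pair_bound hm hn
  exact ⟨B, fun v h1 h2 => (hB v v 0 (Path.refl C 0 v) h1 h2).1⟩

theorem IsConstantBeyond.pairing_add {N : ℤ} (hC : C.IsConstantBeyond N) {m m' n : ℤ → k}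
    (hm : m ∈ C.carrier k) (hm' : m' ∈ C.carrier k) (hn : n ∈ C.invert.carrier k) :
    pairing (m + m') n = pairing m n + pairing m' n := by
  obtain ⟨B, hB⟩ := hC.exists_pairing_support hm hn
  obtain ⟨B', hB'⟩ := hC.exists_pairing_support hm' hn
  rw [pairing, pairing, pairing, ← finsum_add_distrib]
  · exact finsum_congr fun v => add_mul _ _ _
  · exact (Finset.finite_toSet (Finset.Icc (-B) B)).subset fun v hv =>
      hB v (left_ne_zero_of_mul hv) (right_ne_zero_of_mul hv)
  · exact (Finset.finite_toSet (Finset.Icc (-B') B')).subset fun v hv =>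
      hB' v (left_ne_zero_of_mul hv) (right_ne_zero_of_mul hv)

theorem pairing_smul (c : k) (m n : ℤ → k) : pairing (c • m) n = c * pairing m n := by
  rw [pairing, pairing, ← smul_eq_mul, smul_finsum]
  exact finsum_congr fun v => mul_assoc _ _ _

theorem IsConstantBeyond.exists_pairing_eq_zero {N : ℤ} (hC : C.IsConstantBeyond N)
    {m n : ℤ → k} (hm : m ∈ C.carrier k) (hn : n ∈ C.invert.carrier k) :
    ∃ p : ℕ, ∀ f : MvPowerSeries (Fin 2) k,
      (∀ a j, j < p → MvPowerSeries.coeff (Finsupp.single a j) f = 0) →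
      pairing (C.act k f m) n = 0 := by
  obtain ⟨B, hB⟩ := hC.exists_pair_bound hm hn
  -- Two vertices of the box are at distance at most `2 * B`, so only coefficients up to that degree
  -- matter.
  refine ⟨(2 * B + 1).toNat, fun f hf => ?_⟩
  rw [pairing_act_eq_sum f hB]
  refine Finset.sum_eq_zero fun w hw => Finset.sum_eq_zero fun u hu => ?_
  rw [Finset.mem_Icc] at hu hw
  have h : C.pathCoeff k f u w = 0 := by
    by_contra hne
    obtain ⟨a, ha⟩ := exists_path_of_pathCoeff_ne_zero hne
    refine hne ?_
    rw [pathCoeff_of_path ha]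
    exact hf a _ (by omega)
  rw [h, zero_mul, zero_mul]

end Pairing

end StringWord

/-! ### The duality homomorphism -/

namespace StringModule

open StringWord NodeRing

variable {k : Type u} [Field k] {C D : StringWord}

theorem mk_smul_val (f : MvPowerSeries (Fin 2) k) (m : StringModule k C) :
    ((Ideal.Quotient.mk _ f : NodeRing k) • m).1 = C.act k f m.1 := rfl

theorem add_val (m n : StringModule k C) : (m + n).1 = m.1 + n.1 := rfl

theorem smul_val (c : k) (m : StringModule k C) : (c • m).1 = c • m.1 := rfl

instance : IsScalarTower k (NodeRing k) (StringModule k C) where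
  smul_assoc c f m := by
    obtain ⟨f, rfl⟩ := Ideal.Quotient.mk_surjective f
    refine Subtype.ext ?_
    change C.act k (c • f) m.1 = c • C.act k f m.1
    funext w
    rw [Pi.smul_apply, act, act, smul_finsum]
    exact finsum_congr fun u => by rw [pathCoeff_smul, mul_assoc, smul_eq_mul]

section Duality

/-- The functional on `M(C)` which is given by pairing with an element of `M(C⁻)`. -/
noncomputable def pairFunctional {N : ℤ} (hC : C.IsConstantBeyond N) (h : C.invert = D)
    (n : StringModule k D) : StringModule k C →ₗ[k] k where
  toFun m := pairing m.1 n.1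
  map_add' m m' := hC.pairing_add m.2 m'.2 (by rw [h]; exact n.2)
  map_smul' c m := pairing_smul c m.1 n.1

variable {N : ℤ} (hC : C.IsConstantBeyond N) (h : C.invert = D)

theorem isLocallyContinuous_pairFunctional (n : StringModule k D) :
    IsLocallyContinuous (maxIdeal k) (pairFunctional hC h n) := fun m => by
  obtain ⟨p, hp⟩ := hC.exists_pairing_eq_zero m.2 (n := n.1) (by rw [h]; exact n.2)
  refine ⟨p, fun f hf => ?_⟩
  obtain ⟨f, rfl⟩ := Ideal.Quotient.mk_surjective f
  exact hp f fun a j hj => coeff_eq_zero_of_mk_mem_pow hf a hj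

/-- The homomorphism `M(C⁻) → Hom(M(C), E)`. -/
noncomputable def dualHom :
    StringModule k D →ₗ[NodeRing k] (StringModule k C →ₗ[NodeRing k] ContDual k (maxIdeal k)) where
  toFun n := homOfFunctional _ (pairFunctional hC h n) (isLocallyContinuous_pairFunctional hC h n)
  map_add' n n' := LinearMap.ext fun m => Subtype.ext (AlgDual.ext fun f => by
    change pairing (f • m).1 (n + n').1 = pairing (f • m).1 n.1 + pairing (f • m).1 n'.1
    obtain ⟨N, hD⟩ : ∃ N, D.IsConstantBeyond N := ⟨N, h ▸ hC.invert⟩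
    -- Additivity in the second argument is additivity in the first for the string `D`.
    rw [pairing_comm, pairing_comm _ n.1, pairing_comm _ n'.1]
    exact hD.pairing_add n.2 n'.2 (by rw [invert_eq_comm h]; exact (f • m).2))
  map_smul' g n := LinearMap.ext fun m => Subtype.ext (AlgDual.ext fun f => by
    change pairing (f • m).1 (g • n).1 = pairing ((g * f) • m).1 n.1
    obtain ⟨g, rfl⟩ := Ideal.Quotient.mk_surjective g
    rw [mul_smul]
    subst h
    exact (hC.pairing_act g (f • m).2 n.2).symm)

theorem dualHom_apply (n : StringModule k D) (m : StringModule k C) (f : NodeRing k) :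
    (dualHom hC h n m).1 f = pairing (f • m).1 n.1 := rfl

/-- The pairing is symmetric and the action self-adjoint. This symmetry later identifies evaluation
with a composite of duality isomorphisms. -/
theorem dualHom_symm (n : StringModule k D) (m : StringModule k C)
    (hD : D.IsConstantBeyond N) :
    dualHom hC h n m = dualHom hD (invert_eq_comm h) m n := Subtype.ext (AlgDual.ext fun f => by
  rw [dualHom_apply, dualHom_apply, pairing_comm (f • n).1]
  obtain ⟨f, rfl⟩ := Ideal.Quotient.mk_surjective f
  subst h
  exact hC.pairing_act f m.2 n.2)

end Duality

/-! ### Vertices, restrictions and tails -/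

open Classical in
variable (k C) in
/-- The basis vector of a vertex; it is zero for an integer which is not a vertex. -/
noncomputable def delta (v : ℤ) : StringModule k C :=
  ⟨fun w => if w = v ∧ v ∈ C.vertices then 1 else 0, fun w hw => if_neg (by
      rintro ⟨rfl, h⟩
      exact hw h), fun _ => ⟨v - 1, fun w hw => if_neg (by omega)⟩,
    fun _ => ⟨v + 1, fun w hw => if_neg (by omega)⟩⟩

theorem delta_val_self {v : ℤ} (hv : v ∈ C.vertices) : (delta k C v).1 v = 1 :=
  if_pos ⟨rfl, hv⟩

theorem delta_val_of_ne {v w : ℤ} (h : w ≠ v) : (delta k C v).1 w = 0 :=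
  if_neg fun h' => h h'.1

theorem delta_eq_zero {v : ℤ} (hv : v ∉ C.vertices) : delta k C v = 0 :=
  Subtype.ext (funext fun _ => if_neg fun h' => hv h'.2)

theorem pairing_delta {v : ℤ} (hv : v ∈ C.vertices) (n : ℤ → k) :
    pairing (delta k C v).1 n = n v := by
  rw [pairing, finsum_eq_single _ v fun w hw => by rw [delta_val_of_ne hw, zero_mul],
    delta_val_self hv, one_mul]

theorem mk_smul_delta_val (f : MvPowerSeries (Fin 2) k) {v : ℤ} (hv : v ∈ C.vertices) (w : ℤ) :
    ((Ideal.Quotient.mk _ f : NodeRing k) • delta k C v).1 w = C.pathCoeff k f v w := by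
  rw [mk_smul_val, act, finsum_eq_single _ v fun u hu => by rw [delta_val_of_ne hu, mul_zero],
    delta_val_self hv, mul_one]

/-- The restriction of a family to a set of vertices. -/
noncomputable def restrict (S : Set ℤ) (m : StringModule k C) : StringModule k C :=
  ⟨S.indicator m.1, fun v hv => by
      rw [Set.indicator_apply_eq_zero]
      exact fun _ => m.2.1 v hv, fun h => by
      obtain ⟨N, hN⟩ := m.2.2.1 h
      exact ⟨N, fun v hv => by
        rw [Set.indicator_apply_eq_zero]
        exact fun _ => hN v hv⟩, fun h => by
      obtain ⟨N, hN⟩ := m.2.2.2 h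
      exact ⟨N, fun v hv => by
        rw [Set.indicator_apply_eq_zero]
        exact fun _ => hN v hv⟩⟩

theorem restrict_val_of_mem {S : Set ℤ} (m : StringModule k C) {v : ℤ} (hv : v ∈ S) :
    (restrict S m).1 v = m.1 v := Set.indicator_of_mem hv _

theorem restrict_val_of_notMem {S : Set ℤ} (m : StringModule k C) {v : ℤ} (hv : v ∉ S) :
    (restrict S m).1 v = 0 := Set.indicator_of_notMem hv _

theorem sum_val {ι : Type*} (s : Finset ι) (g : ι → StringModule k C) (w : ℤ) :
    (∑ i ∈ s, g i).1 w = ∑ i ∈ s, (g i).1 w :=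
  map_sum ((LinearMap.proj w : (ℤ → k) →ₗ[k] k) ∘ₗ (C.carrier k).subtype) g s

/-- The inner restriction to `Set.Iic B` matters only for negative `B`, when the two tails would
overlap; it makes a sign condition unnecessary. -/
theorem eq_restrict_add (m : StringModule k C) (B : ℤ) :
    m = restrict (Set.Ioi B) m + restrict (Set.Iio (-B)) (restrict (Set.Iic B) m) +
      ∑ v ∈ Finset.Icc (-B) B, m.1 v • delta k C v := by
  refine Subtype.ext (funext fun w => ?_)
  rw [add_val, add_val, Pi.add_apply, Pi.add_apply, sum_val]
  simp only [smul_val, Pi.smul_apply, smul_eq_mul]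
  have hs : ∀ s : Finset ℤ, w ∉ s → ∑ v ∈ s, m.1 v * (delta k C v).1 w = 0 := fun s hs =>
    Finset.sum_eq_zero fun v hv => by
      rw [delta_val_of_ne (by rintro rfl; exact hs hv), mul_zero]
  by_cases h1 : B < w
  · rw [restrict_val_of_mem m (S := Set.Ioi B) h1, hs _ (by rw [Finset.mem_Icc]; omega)]
    by_cases h2 : w < -B
    · rw [restrict_val_of_mem _ (S := Set.Iio (-B)) h2,
        restrict_val_of_notMem _ (by rw [Set.mem_Iic]; omega), add_zero, add_zero]
    · rw [restrict_val_of_notMem _ (S := Set.Iio (-B)) h2, add_zero, add_zero]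
  · rw [restrict_val_of_notMem m (S := Set.Ioi B) h1]
    by_cases h2 : w < -B
    · rw [restrict_val_of_mem _ (S := Set.Iio (-B)) h2,
        restrict_val_of_mem _ (S := Set.Iic B) (by rw [Set.mem_Iic]; omega),
        hs _ (by rw [Finset.mem_Icc]; omega), zero_add, add_zero]
    · rw [restrict_val_of_notMem _ (S := Set.Iio (-B)) h2, zero_add, zero_add,
        Finset.sum_eq_single w (fun v _ hv => by rw [delta_val_of_ne hv.symm, mul_zero])
          (fun h => absurd (Finset.mem_Icc.2 ⟨by omega, by omega⟩) h)]
      by_cases hw : w ∈ C.vertices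
      · rw [delta_val_self hw, mul_one]
      · rw [m.2.1 w hw, zero_mul]

/-- If all arrows on one side of the vertex `u` (where `s = ±1` is the direction) point outward,
then a family which is supported on that side is a multiple of the basis vector of `u`. -/
theorem exists_smul_delta {a : Fin 2} {u s : ℤ} (hs : s = 1 ∨ s = -1) (hu : u ∈ C.vertices)
    (hpath : ∀ j : ℕ, C.Path a u (u + s * j)) (hside : ∀ b w, C.Path b u w → 0 ≤ s * (w - u))
    {p : ℕ} {m : StringModule k C} (hm : ∀ v, m.1 v ≠ 0 → p ≤ s * (v - u)) :
    ∃ f ∈ maxIdeal k ^ p, m = f • delta k C u := by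
  classical
  -- A series in the variable `a` alone, whose coefficients are read off from `m` along the ray
  -- starting at `u`.
  let F : MvPowerSeries (Fin 2) k := fun d =>
    if d = Finsupp.single a (d a) then m.1 (u + s * d a) else 0
  have hF : ∀ d, MvPowerSeries.coeff d F =
    if d = Finsupp.single a (d a) then m.1 (u + s * d a) else 0 := fun d => rfl
  refine ⟨Ideal.Quotient.mk _ F, mk_mem_maxIdeal_pow a fun d hd => ?_,
    Subtype.ext (funext fun w => ?_)⟩
  · rw [hF]
    split_ifs
    · by_contra hne
      have := hm _ hne
      rcases hs with rfl | rfl <;> omega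
    · rfl
  · rw [mk_smul_delta_val _ hu]
    by_cases hw : 0 ≤ s * (w - u)
    · obtain ⟨j, rfl⟩ : ∃ j : ℕ, w = u + s * j :=
        ⟨(w - u).natAbs, by rcases hs with rfl | rfl <;> omega⟩
      have hj : (u - (u + s * j)).natAbs = j := by rcases hs with rfl | rfl <;> omega
      rw [pathCoeff_of_path (hpath j), hj, hF]
      simp
    · have h1 : C.pathCoeff k F u w = 0 := by
        by_contra hne
        obtain ⟨b, hb⟩ := exists_path_of_pathCoeff_ne_zero hne
        exact hw (hside b w hb)
      rw [h1]
      by_contra hne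
      have := hm w hne
      omega

/-- The letter at `N` points into the vertex `N`, so no path leaves that vertex towards the middle,
and the outward ray is generated by it. -/
theorem exists_smul_delta_right {a : Fin 2} {N : ℤ} (hN : ∀ i ≥ N, C.letter i = some (.inv a))
    {p : ℕ} {m : StringModule k C} (hm : ∀ v, m.1 v ≠ 0 → N + p ≤ v) :
    ∃ f ∈ maxIdeal k ^ p, m = f • delta k C N := by
  refine exists_smul_delta (a := a) (s := 1) (Or.inl rfl) (Or.inl ?_) (fun j => ?_)
    (fun b w hb => ?_) fun v hv => ?_
  · simp [support, hN N le_rfl]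
  · exact Or.inr ⟨by omega, fun i hi _ => hN i (by omega)⟩
  · by_contra hlt
    rcases hb with ⟨l, hb⟩ | ⟨l, -⟩
    · have := hb N (by omega) le_rfl
      simp [hN N le_rfl] at this
    · omega
  · have := hm v hv
    omega

/-- The letter at `N` joins `N - 1` to `N` and points into `N - 1`, hence the shifted generator. -/
theorem exists_smul_delta_left {a : Fin 2} {N : ℤ} (hN : ∀ i ≤ N, C.letter i = some (.dir a))
    {p : ℕ} {m : StringModule k C} (hm : ∀ v, m.1 v ≠ 0 → v ≤ N - 1 - p) :
    ∃ f ∈ maxIdeal k ^ p, m = f • delta k C (N - 1) := by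
  refine exists_smul_delta (a := a) (s := -1) (Or.inr rfl) (Or.inl ?_) (fun j => ?_)
    (fun b w hb => ?_) fun v hv => ?_
  · simp [support, hN (N - 1) (by omega)]
  · exact Or.inl ⟨by omega, fun i _ hi => hN i (by omega)⟩
  · by_contra hlt
    rcases hb with ⟨l, hb⟩ | ⟨l, hb⟩
    · omega
    · have := hb N (by omega) (by omega)
      simp [hN N le_rfl] at this
  · have := hm v hv
    omega

/-! ### Every locally continuous functional is a pairing -/

section Surjective

variable {l : StringModule k C →ₗ[k] k}

/-- Continuity at the vertex `N` makes `l` kill the `p`-th power of the maximal ideal times that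
vertex, which contains every family supported from `N + p` on. -/
theorem exists_forall_right_eq_zero (hl : IsLocallyContinuous (maxIdeal k) l)
    {a : Fin 2} {N : ℤ}
    (hN : ∀ i ≥ N, C.letter i = some (.inv a)) :
    ∃ R, ∀ m : StringModule k C, (∀ v, m.1 v ≠ 0 → R ≤ v) → l m = 0 := by
  obtain ⟨p, hp⟩ := hl (delta k C N)
  refine ⟨N + p, fun m hm => ?_⟩
  obtain ⟨f, hf, rfl⟩ := exists_smul_delta_right hN hm
  exact hp f hf

theorem exists_forall_left_eq_zero (hl : IsLocallyContinuous (maxIdeal k) l)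
    {a : Fin 2} {N : ℤ}
    (hN : ∀ i ≤ N, C.letter i = some (.dir a)) :
    ∃ R, ∀ m : StringModule k C, (∀ v, m.1 v ≠ 0 → v ≤ R) → l m = 0 := by
  obtain ⟨p, hp⟩ := hl (delta k C (N - 1))
  refine ⟨N - 1 - p, fun m hm => ?_⟩
  obtain ⟨f, hf, rfl⟩ := exists_smul_delta_left hN hm
  exact hp f hf

/-- There are three kinds of end: past a finite end there are no vertices, at an inward end `m`
vanishes far out, and at an outward end `l` kills the tail. -/
theorem exists_restrict_right (hl : IsLocallyContinuous (maxIdeal k) l)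
    {N : ℤ} (hC : C.IsConstantBeyond N) (m : StringModule k C) :
    ∃ R, ∀ S : Set ℤ, (∀ v ∈ S, R ≤ v) → l (restrict S m) = 0 := by
  obtain ⟨c, hc⟩ := hC.right
  have key : ∀ R, (∀ v, R ≤ v → m.1 v = 0) →
      ∀ S : Set ℤ, (∀ v ∈ S, R ≤ v) → l (restrict S m) = 0 := fun R hR S hS => by
    rw [show restrict S m = 0 from Subtype.ext (funext fun v => by
      by_cases hv : v ∈ S
      · rw [restrict_val_of_mem m hv, hR v (hS v hv)]
        rfl
      · exact restrict_val_of_notMem m hv), map_zero]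
  rcases c with _ | a | a
  · refine ⟨_, key (N + 1) fun v hv => m.2.1 v fun h => ?_⟩
    have := le_of_mem_vertices hC.nonneg hc h
    omega
  · obtain ⟨R, hR⟩ := m.2.2.2 ⟨N, fun i hi => ⟨a, hc i hi⟩⟩
    exact ⟨_, key R hR⟩
  · obtain ⟨R, hR⟩ := exists_forall_right_eq_zero hl hc
    refine ⟨R, fun S hS => hR _ fun v hv => hS v ?_⟩
    by_contra h
    exact hv (restrict_val_of_notMem m h)

theorem exists_restrict_left (hl : IsLocallyContinuous (maxIdeal k) l)
    {N : ℤ} (hC : C.IsConstantBeyond N) (m : StringModule k C) :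
    ∃ R, ∀ S : Set ℤ, (∀ v ∈ S, v ≤ R) → l (restrict S m) = 0 := by
  obtain ⟨c, hc⟩ := hC.left
  have key : ∀ R, (∀ v, v ≤ R → m.1 v = 0) →
      ∀ S : Set ℤ, (∀ v ∈ S, v ≤ R) → l (restrict S m) = 0 := fun R hR S hS => by
    rw [show restrict S m = 0 from Subtype.ext (funext fun v => by
      by_cases hv : v ∈ S
      · rw [restrict_val_of_mem m hv, hR v (hS v hv)]
        rfl
      · exact restrict_val_of_notMem m hv), map_zero]
  rcases c with _ | a | a
  · refine ⟨_, key (-N - 1) fun v hv => m.2.1 v fun h => ?_⟩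
    have := ge_of_mem_vertices hC.nonneg hc h
    omega
  · obtain ⟨R, hR⟩ := exists_forall_left_eq_zero hl hc
    refine ⟨R, fun S hS => hR _ fun v hv => hS v ?_⟩
    by_contra h
    exact hv (restrict_val_of_notMem m h)
  · obtain ⟨R, hR⟩ := m.2.2.1 ⟨-N, fun i hi => ⟨a, hc i hi⟩⟩
    exact ⟨_, key R hR⟩

/-- An inward end of `C⁻` is an outward end of `C`, where `l` kills all far vertices. -/
theorem delta_mem_carrier (hl : IsLocallyContinuous (maxIdeal k) l)
    {N : ℤ} (hC : C.IsConstantBeyond N) :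
    (fun v => l (delta k C v)) ∈ C.invert.carrier k := by
  have hd : ∀ v w, (delta k C v).1 w ≠ 0 → w = v := fun v w h => by
    by_contra hne
    exact h (delta_val_of_ne hne)
  refine ⟨fun v hv => ?_, ?_, ?_⟩
  · rw [vertices_invert] at hv
    exact (congrArg l (delta_eq_zero hv)).trans (map_zero l)
  · rintro ⟨L, hL⟩
    obtain ⟨c, hc⟩ := hC.left
    obtain ⟨a, ha⟩ := hL (min L (-N)) (min_le_left _ _)
    have ha' : C.letter (min L (-N)) = some (.dir a) := letter_eq_iff_invert.2 ha
    rw [hc _ (min_le_right _ _)] at ha'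
    subst ha'
    obtain ⟨R, hR⟩ := exists_forall_left_eq_zero hl hc
    exact ⟨R, fun v hv => hR _ fun w hw => hd v w hw ▸ hv⟩
  · rintro ⟨L, hL⟩
    obtain ⟨c, hc⟩ := hC.right
    obtain ⟨a, ha⟩ := hL (max L N) (le_max_left _ _)
    have ha' : C.letter (max L N) = some (.inv a) := letter_eq_iff_invert.2 ha
    rw [hc _ (le_max_right _ _)] at ha'
    subst ha'
    obtain ⟨R, hR⟩ := exists_forall_right_eq_zero hl hc
    exact ⟨R, fun v hv => hR _ fun w hw => hd v w hw ▸ hv⟩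

/-- Linearity alone does not reach infinite families. Cutting `m` at a large box leaves two tails
killed by `l` and a finite combination of vertices. -/
theorem eq_pairing (hl : IsLocallyContinuous (maxIdeal k) l)
    {N : ℤ} (hC : C.IsConstantBeyond N) (m : StringModule k C) :
    l m = pairing m.1 fun v => l (delta k C v) := by
  obtain ⟨R, hR⟩ := exists_restrict_right hl hC m
  obtain ⟨B, hB⟩ := hC.exists_pairing_support m.2 (delta_mem_carrier hl hC)
  obtain ⟨L, hL⟩ : ∃ L, ∀ B, L ≤ B →
      l (restrict (Set.Iio (-B)) (restrict (Set.Iic B) m)) = 0 := by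
    obtain ⟨L, hL⟩ := exists_restrict_left hl hC m
    refine ⟨|L|, fun B hB => ?_⟩
    have h1 : restrict (Set.Iio (-B)) (restrict (Set.Iic B) m) =
        restrict (Set.Iio (-B) ∩ Set.Iic B) m :=
      Subtype.ext (Set.indicator_indicator _ _ _)
    rw [h1]
    refine hL _ fun v hv => ?_
    have h2 : v < -B := hv.1
    have := neg_abs_le L
    omega
  -- The box must clear the right tail, the support of the pairing and the left tail.
  set B' := max (max R B) L
  rw [pairing_eq_sum (T := Finset.Icc (-B') B') fun v h1 h2 => by
    have := Finset.mem_Icc.1 (hB v h1 h2)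
    rw [Finset.mem_Icc]
    omega]
  conv_lhs => rw [eq_restrict_add m B']
  rw [map_add, map_add, hR _ fun v hv => ?_, hL _ (le_max_right _ _), map_sum, add_zero, zero_add]
  · exact Finset.sum_congr rfl fun v _ => by rw [map_smul, smul_eq_mul]
  · have h2 : B' < v := hv
    omega

end Surjective

/-- Pairing with vertices recovers the coordinates, which gives injectivity. Surjectivity is
`eq_pairing` for the functional obtained by evaluating at `1`. -/
theorem dualHom_bijective {N : ℤ} (hC : C.IsConstantBeyond N) (h : C.invert = D) :
    Function.Bijective (dualHom (k := k) hC h) := by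
  constructor
  · rw [← LinearMap.ker_eq_bot, Submodule.eq_bot_iff]
    intro n hn
    refine Subtype.ext (funext fun v => ?_)
    by_cases hv : v ∈ C.vertices
    · have h1 := dualHom_apply hC h n (delta k C v) 1
      rw [one_smul, pairing_delta hv, LinearMap.mem_ker.1 hn] at h1
      exact h1.symm
    · exact n.2.1 v (by rwa [← h, vertices_invert])
  · intro φ
    have hl := isLocallyContinuous_functionalOfHom φ
    refine ⟨⟨fun v => functionalOfHom φ (delta k C v), h ▸ delta_mem_carrier hl hC⟩,
      LinearMap.ext fun m => Subtype.ext (AlgDual.ext fun f => ?_)⟩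
    exact (eq_pairing hl hC (f • m)).symm.trans (apply_eq_apply_smul φ m f).symm

/-! ### Matlis dual and reflexivity -/

/-- The isomorphism `M(C⁻) ≅ M(C)^∨`. -/
noncomputable def dualEquiv (e : MatlisModule (NodeRing k) ≃ₗ[NodeRing k] ContDual k (maxIdeal k))
    {N : ℤ} (hC : C.IsConstantBeyond N) (h : C.invert = D) :
    StringModule k D ≃ₗ[NodeRing k] MatlisDual (NodeRing k) (StringModule k C) :=
  (LinearEquiv.ofBijective (dualHom (k := k) hC h) (dualHom_bijective hC h)).trans
    (LinearEquiv.congrRight e.symm)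

theorem dualEquiv_apply (e : MatlisModule (NodeRing k) ≃ₗ[NodeRing k] ContDual k (maxIdeal k))
    {N : ℤ} (hC : C.IsConstantBeyond N) (h : C.invert = D) (n : StringModule k D)
    (m : StringModule k C) : dualEquiv e hC h n m = e.symm (dualHom hC h n m) := rfl

/-- By `dualHom_symm`, evaluation is the duality isomorphism for `C⁻` followed by precomposition
with the inverse of the one for `C`. -/
theorem isMatlisReflexive {N : ℤ} (hC : C.IsConstantBeyond N) :
    IsMatlisReflexive (NodeRing k) (StringModule k C) := by
  obtain ⟨e⟩ := nonempty_matlisModule_linearEquiv (augmentation k)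
  have h : C.invert = C.invert := rfl
  let F := dualEquiv e hC h
  let G := dualEquiv e hC.invert (invert_eq_comm h)
  have hev : ⇑(LinearMap.applyₗ : StringModule k C →ₗ[NodeRing k] _ →ₗ[NodeRing k]
      MatlisModule (NodeRing k)) = (LinearEquiv.congrLeft (MatlisModule (NodeRing k))
        (NodeRing k) F) ∘ G := by
    funext m
    refine LinearMap.ext fun φ => ?_
    obtain ⟨n, rfl⟩ := F.surjective φ
    change F n m = G m (F.symm (F n))
    rw [F.symm_apply_apply]
    exact congrArg e.symm (dualHom_symm hC h n m hC.invert)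
  unfold IsMatlisReflexive
  rw [hev]
  exact (LinearEquiv.bijective _).comp G.bijective

/-! ### A noetherian submodule with artinian quotient -/

variable (k C) in
/-- The submodule which is generated by the vertices in `[-B, B]`. -/
noncomputable def deltaSpan (B : ℤ) : Submodule (NodeRing k) (StringModule k C) :=
  Submodule.span (NodeRing k) (delta k C '' Set.Icc (-B) B)

instance (B : ℤ) : IsNoetherian (NodeRing k) (deltaSpan k C B) :=
  isNoetherian_span_of_finite _ ((Set.finite_Icc _ _).image _)

theorem delta_mem_deltaSpan {B v : ℤ} (h1 : -B ≤ v) (h2 : v ≤ B) :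
    delta k C v ∈ deltaSpan k C B :=
  Submodule.subset_span ⟨v, ⟨h1, h2⟩, rfl⟩

/-- A family which vanishes on the inward ends is generated by finitely many vertices. -/
theorem mem_deltaSpan {N : ℤ} (hC : C.IsConstantBeyond N) {m : StringModule k C}
    (hR : C.RightInward → ∀ v > N + 1, m.1 v = 0)
    (hL : C.LeftInward → ∀ v < -(N + 1), m.1 v = 0) : m ∈ deltaSpan k C (N + 1) := by
  have h0 := hC.nonneg
  rw [eq_restrict_add m (N + 1)]
  refine add_mem (add_mem ?_ ?_) (sum_mem fun v hv => ?_)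
  · by_cases hm : ∀ v > N + 1, m.1 v = 0
    · rw [show restrict (Set.Ioi (N + 1)) m = 0 from Subtype.ext (funext fun v => by
        by_cases hv : v ∈ Set.Ioi (N + 1)
        · rw [restrict_val_of_mem m hv, hm v hv]
          rfl
        · exact restrict_val_of_notMem m hv)]
      exact zero_mem _
    · obtain ⟨c, hc⟩ := hC.right
      rcases c with _ | a | a
      · refine absurd (fun v hv => m.2.1 v fun h => ?_) hm
        have := le_of_mem_vertices h0 hc h
        omega
      · exact absurd (hR ⟨N, fun i hi => ⟨a, hc i hi⟩⟩) hm
      · obtain ⟨f, -, hf⟩ := exists_smul_delta_right hc (p := 0)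
          (m := restrict (Set.Ioi (N + 1)) m) fun v hv => by
            by_contra hlt
            refine hv (restrict_val_of_notMem m ?_)
            rw [Set.mem_Ioi]
            omega
        rw [hf]
        exact Submodule.smul_mem _ _ (delta_mem_deltaSpan (by omega) (by omega))
  · set m' := restrict (Set.Iic (N + 1)) m
    by_cases hm : ∀ v < -(N + 1), m.1 v = 0
    · rw [show restrict (Set.Iio (-(N + 1))) m' = 0 from Subtype.ext (funext fun v => by
        by_cases hv : v ∈ Set.Iio (-(N + 1))
        · rw [restrict_val_of_mem m' hv, restrict_val_of_mem m, hm v hv]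
          · rfl
          · have : v < -(N + 1) := hv
            rw [Set.mem_Iic]
            omega
        · exact restrict_val_of_notMem m' hv)]
      exact zero_mem _
    · obtain ⟨c, hc⟩ := hC.left
      rcases c with _ | a | a
      · refine absurd (fun v hv => m.2.1 v fun h => ?_) hm
        have := ge_of_mem_vertices h0 hc h
        omega
      -- The generator of the left tail is the vertex `-N - 1`, which is why the box has radius `N +
      -- 1`.
      · obtain ⟨f, -, hf⟩ := exists_smul_delta_left hc (p := 0)
          (m := restrict (Set.Iio (-(N + 1))) m') fun v hv => by
            by_contra hlt
            refine hv (restrict_val_of_notMem m' ?_)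
            rw [Set.mem_Iio]
            omega
        rw [hf]
        exact Submodule.smul_mem _ _ (delta_mem_deltaSpan (by omega) (by omega))
      · exact absurd (hL ⟨-N, fun i hi => ⟨a, hc i hi⟩⟩) hm
  · rw [Finset.mem_Icc] at hv
    rw [← algebraMap_smul (NodeRing k)]
    exact Submodule.smul_mem _ _ (delta_mem_deltaSpan hv.1 hv.2)

theorem not_rightInward (h : C.RightInward) (h' : C.invert.RightInward) : False := by
  obtain ⟨N, hN⟩ := h
  obtain ⟨N', hN'⟩ := h'
  obtain ⟨a, ha⟩ := hN (max N N') (le_max_left _ _)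
  obtain ⟨b, hb⟩ := hN' (max N N') (le_max_right _ _)
  rw [letter_invert, ha] at hb
  simp [StringLetter.flip] at hb

theorem not_leftInward (h : C.LeftInward) (h' : C.invert.LeftInward) : False := by
  obtain ⟨N, hN⟩ := h
  obtain ⟨N', hN'⟩ := h'
  obtain ⟨a, ha⟩ := hN (min N N') (min_le_left _ _)
  obtain ⟨b, hb⟩ := hN' (min N N') (min_le_right _ _)
  rw [letter_invert, ha] at hb
  simp [StringLetter.flip] at hb

/-- It suffices that the dual of the quotient is noetherian. That dual consists of the functionals
vanishing on the box submodule, and as families on `C⁻` they lie in the box submodule there. -/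
theorem isArtinian_quotient_deltaSpan {N : ℤ} (hC : C.IsConstantBeyond N) :
    IsArtinian (NodeRing k) (StringModule k C ⧸ deltaSpan k C (N + 1)) := by
  obtain ⟨e⟩ := nonempty_matlisModule_linearEquiv (augmentation k)
  have h0 := hC.nonneg
  let F := dualEquiv e hC (rfl : C.invert = C.invert)
  let ρ : MatlisDual (NodeRing k) (StringModule k C ⧸ deltaSpan k C (N + 1)) →ₗ[NodeRing k]
      StringModule k C.invert :=
    F.symm.toLinearMap ∘ₗ LinearMap.lcomp (NodeRing k) _ (deltaSpan k C (N + 1)).mkQ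
  have hρ : ∀ ψ v, delta k C v ∈ deltaSpan k C (N + 1) → (ρ ψ).1 v = 0 := by
    intro ψ v hv
    by_cases hvC : v ∈ C.vertices
    · have h1 : F (ρ ψ) (delta k C v) = 0 := by
        have h2 : F (ρ ψ) = ψ ∘ₗ (deltaSpan k C (N + 1)).mkQ := F.apply_symm_apply _
        rw [h2, LinearMap.comp_apply, show (deltaSpan k C (N + 1)).mkQ (delta k C v) = 0 from
          (Submodule.Quotient.mk_eq_zero _).2 hv, map_zero]
      rw [dualEquiv_apply, LinearEquiv.map_eq_zero_iff] at h1
      have h3 := dualHom_apply hC rfl (ρ ψ) (delta k C v) 1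
      rw [one_smul, pairing_delta hvC, h1] at h3
      exact h3.symm
    · exact (ρ ψ).2.1 v (by rwa [vertices_invert])
  -- Where `C⁻` has an inward end, `C` has none on that side, so the far vertices of `C` there lie
  -- in the box submodule and the coordinates of `ρ ψ` vanish at them.
  have hmem : ∀ ψ, ρ ψ ∈ deltaSpan k C.invert (N + 1) := by
    intro ψ
    refine mem_deltaSpan hC.invert (fun h v hv => hρ ψ v ?_) fun h v hv => hρ ψ v ?_
    · refine mem_deltaSpan hC (fun h' => (not_rightInward h' h).elim) fun _ w hw => ?_
      exact delta_val_of_ne (by omega)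
    · refine mem_deltaSpan hC (fun _ w hw => ?_) fun h' => (not_leftInward h' h).elim
      exact delta_val_of_ne (by omega)
  have : IsNoetherian (NodeRing k)
      (MatlisDual (NodeRing k) (StringModule k C ⧸ deltaSpan k C (N + 1))) := by
    refine isNoetherian_of_injective (ρ.codRestrict _ hmem) fun φ ψ hφψ => ?_
    have h1 := F.symm.injective (congrArg Subtype.val hφψ)
    exact LinearMap.ext fun x => by
      obtain ⟨x, rfl⟩ := Submodule.mkQ_surjective _ x
      exact LinearMap.congr_fun h1 x
  exact isArtinian_of_isNoetherian_matlisDual _ _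

end StringModule

theorem lemma7p5 (k : Type u) [Field k] (C : StringWord)
    (hC : C.IsFinite ∨ C.IsStabilising) :
    IsArtinianByNoetherian (NodeRing k) (StringModule k C) ∧
      IsMatlisReflexive (NodeRing k) (StringModule k C) ∧
      Nonempty (MatlisDual (NodeRing k) (StringModule k C) ≃ₗ[NodeRing k]
        StringModule k C.invert) := by
  obtain ⟨N, hN⟩ := StringWord.exists_isConstantBeyond hC
  obtain ⟨e⟩ := nonempty_matlisModule_linearEquiv (NodeRing.augmentation k)
  exact ⟨⟨StringModule.deltaSpan k C (N + 1), inferInstance,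
    StringModule.isArtinian_quotient_deltaSpan hN⟩, StringModule.isMatlisReflexive hN,
    ⟨(StringModule.dualEquiv e hN rfl).symm⟩⟩
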